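/- Let $k,d\in\mathbb{N}$, let $p\ge 1$ be real, let $(X,Y)$ be a random vector in $\mathbb{R}^k\times\mathbb{R}^d$, and let $(X_i,Y_i)_{i\ge 1}$ be independent copies of $(X,Y)$, independent of $(X,Y)$. Let $W_{ni}(x)=W_{ni}(x;X_1,\dots,X_n)$, $1\le i\le n$, $n\ge 1$, be probability weights: measurable functions of $x\in\mathbb{R}^k$ and $X_1,\dots,X_n$ with $W_{ni}(x)\ge 0$ and $\sum_{i=1}^n W_{ni}(x)=1$. Assume that they satisfy the three conditions of Stone's theorem: i) there is $C>0$ such that $\mathbb{E}\big[\sum_{i=1}^n W_{ni}(X)g(X_i)\big]\le C\,\mathbb{E}[g(X)]$ for all $n\ge 1$ and all measurable $g:\mathbb{R}^k\to[0,+\infty)$ with $\mathbb{E}[g(X)]<\infty$; ii) for all $\varepsilon>0$, $\sum_{i=1}^n W_{ni}(X)\mathbf{1}_{\{\|X_i-X\|>\varepsilon\}}\to 0$ in probability as $n\to\infty$; iii) $\max_{1\le i\le n}W_{ni}(X)\to 0$ in probability as $n\to\infty$. Let $\mathcal{W}_p(\mathbb{R}^d)$ be the set of Borel probability measures $\mu$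 on $\mathbb{R}^d$ with $M_p(\mu)=\big(\int\|y\|^p\,\mu(dy)\big)^{1/p}<\infty$, endowed with the distance $\mathcal{W}_p(\mu,\nu)=\inf_\pi\big(\int\|y_1-y_2\|^p\,\pi(dy_1dy_2)\big)^{1/p}$, where the infimum runs over the measures $\pi$ on $\mathbb{R}^d\times\mathbb{R}^d$ with margins $\mu$ and $\nu$. Let $F_x$ be the conditional distribution of $Y$ given $X=x$, let $\hat F_{n,x}=\sum_{i=1}^n W_{ni}(x)\delta_{Y_i}$, and let $S:\mathcal{W}_p(\mathbb{R}^d)\to\mathbb{R}$ be a statistic with continuity set $\mathcal{C}\subset\mathcal{W}_p(\mathbb{R}^d)$ (the set of points at which $S$ is continuous), such that the estimators $S(\hat F_{n,X})$, $n\ge 1$, are random variables. Assume $\mathbb{E}[\|Y\|^p]<\infty$ and $\mathbb{P}(F_X\in\mathcal{C})=1$. Then $$S(\hat F_{n,X})\longrightarrow S(F_X)\quad\text{in probability as } n\to\infty.$$ If furthermore there are $a,b\ge 0$ and $0<q\le p$ such that $|S(\mu)|\le a\,M_p(\mu)^q+b$ for all $\mu\in\mathcal{W}_p(\mathbb{R}^d)$,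 then $$\mathbb{E}\big[|S(\hat F_{n,X})-S(F_X)|^{p/q}\big]\longrightarrow 0\quad\text{as } n\to\infty.$$ -/

import Mathlib

open MeasureTheory ProbabilityTheory Filter Topology
open scoped ENNReal NNReal

noncomputable section

/-! ### Wasserstein spaces on `ℝ^d` -/

/-- `μ` is a Borel probability measure on `ℝ^d` with a finite moment of order `p`. -/
def HasFiniteMoment (p : ℝ) {d : ℕ} (μ : Measure (EuclideanSpace ℝ (Fin d))) : Prop :=
  IsProbabilityMeasure μ ∧ ∫⁻ y, ‖y‖ₑ ^ p ∂μ < ∞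

/-- The Wasserstein space of order `p`: Borel probability measures on `ℝ^d` with a finite moment
of order `p`. -/
structure WassersteinSpace (p : ℝ) (d : ℕ) where
  /-- the underlying measure -/
  toMeasure : Measure (EuclideanSpace ℝ (Fin d))
  hasFiniteMoment : HasFiniteMoment p toMeasure

namespace WassersteinSpace

variable {p : ℝ} {d : ℕ}

/-- `M_p(μ) = (∫ ‖y‖^p μ(dy))^(1/p)`. -/
def moment (μ : WassersteinSpace p d) : ℝ :=
  (∫ y, ‖y‖ ^ p ∂μ.toMeasure) ^ (1 / p)

/-- The couplings of `μ` and `ν`: measures on `ℝ^d × ℝ^d` with margins `μ` and `ν`. -/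
def couplings (μ ν : WassersteinSpace p d) :
    Set (Measure (EuclideanSpace ℝ (Fin d) × EuclideanSpace ℝ (Fin d))) :=
  {π | π.map Prod.fst = μ.toMeasure ∧ π.map Prod.snd = ν.toMeasure}

/-- The Wasserstein distance of order `p` (as an extended nonnegative real). -/
def wdist (μ ν : WassersteinSpace p d) : ℝ≥0∞ :=
  ⨅ π ∈ couplings μ ν, (∫⁻ z, ‖z.1 - z.2‖ₑ ^ p ∂π) ^ (1 / p)

/-- The set of points at which `S` is continuous for the Wasserstein distance of order `p`. -/
def continuitySet (S : WassersteinSpace p d → ℝ) : Set (WassersteinSpace p d) :=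
  {μ | ∀ ε : ℝ, 0 < ε → ∃ δ : ℝ≥0∞, 0 < δ ∧ ∀ ν, wdist μ ν < δ → |S ν - S μ| < ε}

end WassersteinSpace

/-! ### Local probability weights -/

/-- Local probability weights `W_{ni}(x) = W_{ni}(x; x₁, …, x_n)`, `1 ≤ i ≤ n`: measurable functions
of `x` and of the covariates `x₁, …, x_n`, nonnegative and summing up to one. -/
structure LocalWeights (k : ℕ) where
  /-- the weight `W_{ni}(x; x₁, …, x_n)` -/
  weight (n : ℕ+) (i : Fin n) (x : EuclideanSpace ℝ (Fin k))
    (xs : Fin n → EuclideanSpace ℝ (Fin k)) : ℝ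
  measurable (n : ℕ+) (i : Fin n) :
    Measurable fun z : EuclideanSpace ℝ (Fin k) × (Fin n → EuclideanSpace ℝ (Fin k)) =>
      weight n i z.1 z.2
  nonneg (n : ℕ+) (i : Fin n) (x : EuclideanSpace ℝ (Fin k))
    (xs : Fin n → EuclideanSpace ℝ (Fin k)) : 0 ≤ weight n i x xs
  sum_eq_one (n : ℕ+) (x : EuclideanSpace ℝ (Fin k))
    (xs : Fin n → EuclideanSpace ℝ (Fin k)) : ∑ i, weight n i x xs = 1

namespace LocalWeights

variable {k d : ℕ} {Ω : Type*} [MeasurableSpace Ω]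

/-- The random weight `W_{ni}(X) = W_{ni}(X; X₁, …, X_n)`. The covariates `X₁, X₂, …` of the sample
are `Xs 0, Xs 1, …`. -/
def atX (W : LocalWeights k) (X : Ω → EuclideanSpace ℝ (Fin k))
    (Xs : ℕ → Ω → EuclideanSpace ℝ (Fin k)) (n : ℕ+) (i : Fin n) (ω : Ω) : ℝ :=
  W.weight n i (X ω) fun j : Fin n => Xs j ω

/-- Stone's conditions i), ii), iii) on the weights, for the evaluation point `X` and the sample of
covariates `Xs` under the probability measure `P`. -/
structure StoneConditions (W : LocalWeights k) (P : Measure Ω)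
    (X : Ω → EuclideanSpace ℝ (Fin k)) (Xs : ℕ → Ω → EuclideanSpace ℝ (Fin k)) : Prop where
  bound : ∃ C : ℝ≥0, 0 < C ∧ ∀ (n : ℕ+) (g : EuclideanSpace ℝ (Fin k) → ℝ≥0), Measurable g →
    ∫⁻ ω, g (X ω) ∂P < ∞ →
    ∫⁻ ω, ∑ i : Fin n, ENNReal.ofReal (W.atX X Xs n i ω) * g (Xs i ω) ∂P
      ≤ C * ∫⁻ ω, g (X ω) ∂P
  localization : ∀ ε : ℝ, 0 < ε → TendstoInMeasure P
    (fun (n : ℕ+) ω => ∑ i : Fin n,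
      W.atX X Xs n i ω * {x | ε < ‖x - X ω‖}.indicator (fun _ => (1 : ℝ)) (Xs i ω))
    atTop (fun _ => 0)
  max_weight : TendstoInMeasure P (fun (n : ℕ+) ω => ⨆ i : Fin n, W.atX X Xs n i ω)
    atTop (fun _ => 0)

/-- The weighted empirical distribution has finite moments. -/
theorem hasFiniteMoment_empirical (W : LocalWeights k) {p : ℝ} (hp : 0 ≤ p) (n : ℕ+)
    (x : EuclideanSpace ℝ (Fin k)) (xs : Fin n → EuclideanSpace ℝ (Fin k))
    (ys : Fin n → EuclideanSpace ℝ (Fin d)) :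
    HasFiniteMoment p
      (∑ i : Fin n, ENNReal.ofReal (W.weight n i x xs) • Measure.dirac (ys i)) := by
  refine ⟨⟨?_⟩, ?_⟩
  · simp only [Measure.coe_finsetSum, Finset.sum_apply, Measure.smul_apply, measure_univ,
      smul_eq_mul, mul_one]
    rw [← ENNReal.ofReal_sum_of_nonneg fun i _ => W.nonneg n i x xs, W.sum_eq_one,
      ENNReal.ofReal_one]
  · rw [lintegral_finsetSum_measure]
    refine ENNReal.sum_lt_top.2 fun i _ => ?_
    rw [lintegral_smul_measure, lintegral_dirac, smul_eq_mul]
    exact ENNReal.mul_lt_top ENNReal.ofReal_lt_top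
      (ENNReal.rpow_lt_top_of_nonneg hp enorm_ne_top)

/-- The weighted empirical distribution `∑ i, W_{ni}(x) δ_{y_i}` as an element of the Wasserstein
space of order `p`. -/
def empirical (W : LocalWeights k) {p : ℝ} (hp : 1 ≤ p) (n : ℕ+)
    (x : EuclideanSpace ℝ (Fin k)) (xs : Fin n → EuclideanSpace ℝ (Fin k))
    (ys : Fin n → EuclideanSpace ℝ (Fin d)) : WassersteinSpace p d :=
  ⟨∑ i : Fin n, ENNReal.ofReal (W.weight n i x xs) • Measure.dirac (ys i),
    W.hasFiniteMoment_empirical (zero_le_one.trans hp) n x xs ys⟩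

/-- The plug-in estimator `S(F̂_{n,X})` built on the sample `(X_i, Y_i)`, `1 ≤ i ≤ n`, which is
`(Xs i, Ys i)`, `0 ≤ i < n`. -/
def plugIn (W : LocalWeights k) {p : ℝ} (hp : 1 ≤ p) (S : WassersteinSpace p d → ℝ)
    (X : Ω → EuclideanSpace ℝ (Fin k)) (Xs : ℕ → Ω → EuclideanSpace ℝ (Fin k))
    (Ys : ℕ → Ω → EuclideanSpace ℝ (Fin d)) (n : ℕ+) (ω : Ω) : ℝ :=
  S (W.empirical hp n (X ω) (fun i : Fin n => Xs i ω) (fun i : Fin n => Ys i ω))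

end LocalWeights

open Classical in
/-- The conditional statistic `S(F_X)`, with `F_x` the conditional distribution of `Y` given
`X = x`. If `Y` has a finite moment of order `p`, then `F_X` lies almost surely in the Wasserstein
space; the value `0` is used on the exceptional null event. -/
def condStatistic {k d : ℕ} {p : ℝ} {Ω : Type*} [MeasurableSpace Ω] (P : Measure Ω)
    [IsFiniteMeasure P] (S : WassersteinSpace p d → ℝ) (X : Ω → EuclideanSpace ℝ (Fin k))
    (Y : Ω → EuclideanSpace ℝ (Fin d)) (ω : Ω) : ℝ :=
  if h : HasFiniteMoment p (condDistrib Y X P (X ω)) then S ⟨condDistrib Y X P (X ω), h⟩ else 0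

end

/-!
The theorem follows from Stone's theorem for indicators and from a bound of the Wasserstein distance
by the masses of finitely many cells.

**Coupling.** Two probability measures `μ`, `ν` can be coupled so that the two points lie in
different cells of a finite partition with probability at most `∑ j, (μ A_j - ν A_j)⁺`
(`exists_coupling_of_simpleFunc`). Choosing a partition of mesh `ε` on the ball of radius `R`, the
`p`-th power of the Wasserstein distance is at most `ε ^ p`, plus a multiple of the discrepancies of
the masses of the finitely many cells, plus a multiple of the tails `∫_{‖y‖ > R} ‖y‖ ^ p` of both
measures (`WassersteinSpace.wdist_rpow_le`).

**Stone's theorem.** The bound is applied to the conditional law `F_X` and to the weighted empirical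
law. Given all covariates and all other responses, `Y_i` has law `F_{X_i}`. Hence Stone's first
condition passes from covariates to responses, which makes the tails small in mean uniformly in
the sample size (`LocalWeights.StoneConditions.exists_bound_condDistrib_add`). The masses of a cell
converge in mean (`LocalWeights.StoneConditions.tendsto_lintegral_sum_indicator`): the residuals of
different observations are uncorrelated, so their weighted sum has second moment at most the mean of
the largest weight, and the conditional probabilities are averaged locally after an approximation by
a continuous function with compact support.

**Plug-in estimators.** Consequently any subsequence has a further one along which the Wasserstein
distance tends to zero almost surely, and there the continuity of `S` at `F_X` applies. For the
convergence of moments, the growth condition bounds the power `p / q` of the error by a constant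
depending on `R` plus the same tails; truncating at that constant, convergence in probability
concludes.
-/

noncomputable section

/-! ### Couplings and the Wasserstein distance -/

/-- Restricting a finite measure to the cells of a finite partition and adding up gives it back. -/
theorem sum_restrict_preimage_singleton {α β : Type*} [MeasurableSpace α] (c : SimpleFunc α β)
    (μ : Measure α) : ∑ j ∈ c.range, μ.restrict (c ⁻¹' {j}) = μ := by
  ext s hs
  have h := c.sum_range_measure_preimage_singleton (μ.restrict s)
  rw [Measure.restrict_apply_univ] at h
  rw [← h, Measure.finsetSum_apply]
  refine Finset.sum_congr rfl fun j _ => ?_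
  rw [Measure.restrict_apply hs, Measure.restrict_apply (c.measurableSet_fiber j), Set.inter_comm]

theorem measure_map_finsetSum {ι α β : Type*} [MeasurableSpace α] [MeasurableSpace β] {f : α → β}
    (hf : Measurable f) (s : Finset ι) (m : ι → Measure α) :
    (∑ j ∈ s, m j).map f = ∑ j ∈ s, (m j).map f := by
  ext t ht
  simp [Measure.map_apply hf ht, Measure.finsetSum_apply]

/-- Two probability measures can be coupled so that the probability of falling into two different
cells of a finite partition is the total variation distance of the induced discrete laws: on the
common mass of a cell the two points are drawn independently in that cell, and the excess
masses are coupled independently. -/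
theorem exists_coupling_of_simpleFunc {α β : Type*} [MeasurableSpace α]
    (μ ν : Measure α) [IsProbabilityMeasure μ] [IsProbabilityMeasure ν] (c : SimpleFunc α β) :
    ∃ π : Measure (α × α), π.map Prod.fst = μ ∧ π.map Prod.snd = ν ∧
      π {z | c z.1 ≠ c z.2} ≤ ∑ j ∈ c.range, (μ (c ⁻¹' {j}) - ν (c ⁻¹' {j})) := by
  classical
  set a : β → ℝ≥0∞ := fun j => μ (c ⁻¹' {j})
  set b : β → ℝ≥0∞ := fun j => ν (c ⁻¹' {j})
  have hat (j) : a j ≠ ∞ := measure_ne_top _ _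
  have hbt (j) : b j ≠ ∞ := measure_ne_top _ _
  set m : ℝ≥0∞ := ∑ j ∈ c.range, (a j - b j) with hm
  have hmt : m ≠ ∞ := (ENNReal.sum_lt_top.2 fun j _ => (tsub_le_self.trans_lt (hat j).lt_top)).ne
  -- the excess masses on both sides agree since both measures have total mass one
  have hm' : ∑ j ∈ c.range, (b j - a j) = m := by
    have h1 : m + ∑ j ∈ c.range, min (a j) (b j) = 1 := by
      rw [hm, ← Finset.sum_add_distrib, ← measure_univ (μ := μ),
        ← c.sum_range_measure_preimage_singleton μ]
      exact Finset.sum_congr rfl fun j _ => tsub_add_min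
    have h2 : ∑ j ∈ c.range, (b j - a j) + ∑ j ∈ c.range, min (a j) (b j) = 1 := by
      rw [← Finset.sum_add_distrib, ← measure_univ (μ := ν),
        ← c.sum_range_measure_preimage_singleton ν]
      exact Finset.sum_congr rfl fun j _ => by rw [min_comm]; exact tsub_add_min
    refine (ENNReal.add_left_inj ?_).1 (h2.trans h1.symm)
    exact ne_top_of_le_ne_top ENNReal.one_ne_top (h1 ▸ le_add_self)
  set μ' : Measure α := ∑ j ∈ c.range, ((a j - b j) / a j) • μ.restrict (c ⁻¹' {j}) with hμ'
  set ν' : Measure α := ∑ j ∈ c.range, ((b j - a j) / b j) • ν.restrict (c ⁻¹' {j}) with hν'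
  have key (x y : ℝ≥0∞) (hx : x ≠ ∞) : (x - y) / x * x = x - y := by
    rcases eq_or_ne x 0 with rfl | h
    · simp
    · exact ENNReal.div_mul_cancel h hx
  have hμ'm : μ' Set.univ = m := by
    rw [hμ', Measure.finsetSum_apply]
    refine Finset.sum_congr rfl fun j _ => ?_
    rw [Measure.smul_apply, Measure.restrict_apply_univ, smul_eq_mul]
    exact key _ _ (hat j)
  have hν'm : ν' Set.univ = m := by
    rw [hν', Measure.finsetSum_apply, ← hm']
    refine Finset.sum_congr rfl fun j _ => ?_
    rw [Measure.smul_apply, Measure.restrict_apply_univ, smul_eq_mul]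
    exact key _ _ (hbt j)
  have : IsFiniteMeasure μ' := ⟨hμ'm ▸ hmt.lt_top⟩
  have : IsFiniteMeasure ν' := ⟨hν'm ▸ hmt.lt_top⟩
  have hm_smul (ξ : Measure α) (hξ : ξ Set.univ = m) : m⁻¹ • m • ξ = ξ := by
    rcases eq_or_ne m 0 with h | h
    · have : ξ = 0 := Measure.measure_univ_eq_zero.1 (hξ.trans h)
      simp [this]
    · rw [smul_smul, ENNReal.inv_mul_cancel h hmt, one_smul]
  set w : β → ℝ≥0∞ := fun j => min (a j) (b j) / (a j * b j)
  have hsplit (x y : ℝ≥0∞) (hx : x ≠ ∞) (hy : y ≠ ∞) (hx0 : x ≠ 0) :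
      min x y / (x * y) * y + (x - y) / x = 1 := by
    have h1 : min x y / (x * y) * y = min x y / x := by
      rcases eq_or_ne y 0 with rfl | h
      · simp
      · rw [div_eq_mul_inv, ENNReal.mul_inv (Or.inl hx0) (Or.inl hx), mul_assoc, mul_assoc,
          ENNReal.inv_mul_cancel h hy, mul_one, div_eq_mul_inv]
    rw [h1, ENNReal.div_add_div_same, add_comm, tsub_add_min, ENNReal.div_self hx0 hx]
  refine ⟨∑ j ∈ c.range, w j • (μ.restrict (c ⁻¹' {j})).prod (ν.restrict (c ⁻¹' {j}))
    + m⁻¹ • μ'.prod ν', ?_, ?_, ?_⟩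
  · rw [Measure.map_add _ _ measurable_fst, Measure.map_smul, measure_map_finsetSum measurable_fst,
      Measure.map_fst_prod, hν'm, hm_smul _ hμ'm, hμ', ← Finset.sum_add_distrib]
    conv_rhs => rw [← sum_restrict_preimage_singleton c μ]
    refine Finset.sum_congr rfl fun j _ => ?_
    rw [Measure.map_smul, Measure.map_fst_prod, Measure.restrict_apply_univ, smul_smul, ← add_smul]
    rcases eq_or_ne (a j) 0 with h | h
    · rw [Measure.restrict_eq_zero.2 h, smul_zero]
    · rw [hsplit _ _ (hat j) (hbt j) h, one_smul]
  · rw [Measure.map_add _ _ measurable_snd, Measure.map_smul, measure_map_finsetSum measurable_snd,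
      Measure.map_snd_prod, hμ'm, hm_smul _ hν'm, hν', ← Finset.sum_add_distrib]
    conv_rhs => rw [← sum_restrict_preimage_singleton c ν]
    refine Finset.sum_congr rfl fun j _ => ?_
    rw [Measure.map_smul, Measure.map_snd_prod, Measure.restrict_apply_univ, smul_smul, ← add_smul]
    rcases eq_or_ne (b j) 0 with h | h
    · rw [Measure.restrict_eq_zero.2 h, smul_zero]
    · have := hsplit _ _ (hbt j) (hat j) h
      rw [min_comm, mul_comm (b j)] at this
      rw [this, one_smul]
  · rw [Measure.add_apply, Measure.finsetSum_apply, Finset.sum_eq_zero, zero_add]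
    · calc (m⁻¹ • μ'.prod ν') {z | c z.1 ≠ c z.2}
          ≤ (m⁻¹ • μ'.prod ν') Set.univ := measure_mono (Set.subset_univ _)
        _ = m⁻¹ * (m * m) := by
          rw [Measure.smul_apply, ← Set.univ_prod_univ, Measure.prod_prod, hμ'm, hν'm, smul_eq_mul]
        _ ≤ m := by
          rw [← mul_assoc]
          exact mul_le_of_le_one_left' (ENNReal.inv_mul_le_one m)
    · intro j _
      rw [Measure.smul_apply, Measure.prod_restrict, Measure.restrict_apply'
        ((c.measurableSet_fiber j).prod (c.measurableSet_fiber j))]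
      have : {z : α × α | c z.1 ≠ c z.2} ∩ (c ⁻¹' {j}) ×ˢ (c ⁻¹' {j}) = ∅ := by
        ext z
        simp only [Set.mem_inter_iff, Set.mem_ofPred_eq, Set.mem_prod, Set.mem_preimage,
          Set.mem_singleton_iff, Set.mem_empty_iff_false, iff_false]
        rintro ⟨h, h1, h2⟩
        exact h (h1.trans h2.symm)
      rw [this, measure_empty, smul_zero]

/-- The tail `‖y‖ ^ p` on `‖y‖ > R`, zero elsewhere. -/
def tailPow {F : Type*} [NormedAddCommGroup F] (p : ℝ) (R : ℝ≥0) (y : F) : ℝ≥0∞ :=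
  {y : F | (R : ℝ≥0∞) < ‖y‖ₑ}.indicator (fun y => ‖y‖ₑ ^ p) y

section tailPow

variable {F : Type*} [NormedAddCommGroup F] {p : ℝ} {R : ℝ≥0}

theorem measurable_tailPow [MeasurableSpace F] [BorelSpace F] :
    Measurable (tailPow p R : F → ℝ≥0∞) :=
  (measurable_enorm.pow_const p).indicator (measurableSet_lt measurable_const measurable_enorm)

theorem enorm_rpow_le_add_tailPow (hp : 0 ≤ p) (y : F) :
    ‖y‖ₑ ^ p ≤ (R : ℝ≥0∞) ^ p + tailPow p R y := by
  by_cases h : (R : ℝ≥0∞) < ‖y‖ₑ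
  · rw [tailPow, Set.indicator_of_mem (by exact h)]
    exact le_add_self
  · exact (ENNReal.rpow_le_rpow (not_lt.1 h) hp).trans le_self_add

theorem tailPow_le (y : F) : tailPow p R y ≤ ‖y‖ₑ ^ p :=
  Set.indicator_le_self' (fun _ _ => zero_le) y

/-- The tails of a finite moment vanish. -/
theorem tendsto_lintegral_tailPow [MeasurableSpace F] [BorelSpace F] {μ : Measure F}
    (hμ : ∫⁻ y, ‖y‖ₑ ^ p ∂μ ≠ ∞) :
    Tendsto (fun N : ℕ => ∫⁻ y, tailPow p N y ∂μ) atTop (𝓝 0) := by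
  have := tendsto_lintegral_filter_of_dominated_convergence (μ := μ) (l := atTop)
    (F := fun (N : ℕ) y => tailPow p N y) (f := fun _ => 0) (fun y => ‖y‖ₑ ^ p)
    (.of_forall fun _ => measurable_tailPow)
    (.of_forall fun _ => .of_forall tailPow_le) hμ
    (.of_forall fun y => ?_)
  · simpa using this
  · obtain ⟨N, hN⟩ := exists_nat_ge ‖y‖₊
    refine tendsto_const_nhds.congr' ?_
    filter_upwards [eventually_ge_atTop N] with n hn
    rw [tailPow, Set.indicator_of_notMem]
    simp only [Set.mem_ofPred_eq, not_lt, enorm_eq_nnnorm, ENNReal.coe_le_coe]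
    exact hN.trans (by exact_mod_cast hn)

/-- The transport cost is small for two points of the ball of radius `R` lying in the same cell,
at most `(2R) ^ p` for points in different cells, and controlled by the tails otherwise. -/
theorem enorm_sub_rpow_le {β : Type*} (hp : 0 ≤ p) {c : F → β} {ε : ℝ≥0∞}
    (hc : ∀ y₁ y₂ : F, ‖y₁‖ₑ ≤ R → ‖y₂‖ₑ ≤ R → c y₁ = c y₂ → ‖y₁ - y₂‖ₑ ≤ ε) (y₁ y₂ : F) :
    ‖y₁ - y₂‖ₑ ^ p ≤ ε ^ p + 2 ^ p * (tailPow p R y₁ + tailPow p R y₂)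
      + {z : F × F | c z.1 ≠ c z.2}.indicator (fun _ => (2 * R : ℝ≥0∞) ^ p) (y₁, y₂) := by
  have hmax : ‖y₁ - y₂‖ₑ ≤ 2 * max ‖y₁‖ₑ ‖y₂‖ₑ := by
    rw [two_mul]
    exact enorm_sub_le.trans (add_le_add (le_max_left _ _) (le_max_right _ _))
  by_cases hR : max ‖y₁‖ₑ ‖y₂‖ₑ ≤ R
  · by_cases h : c y₁ = c y₂
    · refine (ENNReal.rpow_le_rpow (hc _ _ ((le_max_left _ _).trans hR)
        ((le_max_right _ _).trans hR) h) hp).trans ?_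
      rw [add_assoc]
      exact le_self_add
    · rw [Set.indicator_of_mem (by exact h)]
      refine le_trans (ENNReal.rpow_le_rpow (hmax.trans ?_) hp) le_add_self
      gcongr
  · have h1 : ‖y₁ - y₂‖ₑ ^ p ≤ 2 ^ p * (tailPow p R y₁ + tailPow p R y₂) := by
      refine (ENNReal.rpow_le_rpow hmax hp).trans ?_
      rw [ENNReal.mul_rpow_of_nonneg _ _ hp]
      gcongr
      rw [not_le] at hR
      rcases max_cases ‖y₁‖ₑ ‖y₂‖ₑ with ⟨h, -⟩ | ⟨h, -⟩ <;> rw [h] at hR ⊢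
      · refine le_trans (le_of_eq ?_) le_self_add
        rw [tailPow, Set.indicator_of_mem (by exact hR)]
      · refine le_trans (le_of_eq ?_) le_add_self
        rw [tailPow, Set.indicator_of_mem (by exact hR)]
    exact h1.trans (le_add_self.trans le_self_add)

end tailPow

namespace WassersteinSpace

/-- Upper bound for the Wasserstein distance by the masses of the cells of a finite partition that
is fine on the ball of radius `R`, and by the tails of both measures. -/
theorem wdist_rpow_le {p : ℝ} (hp : 1 ≤ p) {d : ℕ} {β : Type*} (μ ν : WassersteinSpace p d)
    {R : ℝ≥0} {ε : ℝ≥0∞} (c : SimpleFunc (EuclideanSpace ℝ (Fin d)) β)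
    (hc : ∀ y₁ y₂, ‖y₁‖ₑ ≤ R → ‖y₂‖ₑ ≤ R → c y₁ = c y₂ → ‖y₁ - y₂‖ₑ ≤ ε) :
    wdist μ ν ^ p ≤ ε ^ p
      + 2 ^ p * (∫⁻ y, tailPow p R y ∂μ.toMeasure + ∫⁻ y, tailPow p R y ∂ν.toMeasure)
      + (2 * R : ℝ≥0∞) ^ p *
        ∑ j ∈ c.range, (μ.toMeasure (c ⁻¹' {j}) - ν.toMeasure (c ⁻¹' {j})) := by
  have hp0 : 0 < p := by linarith
  have := μ.hasFiniteMoment.1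
  have := ν.hasFiniteMoment.1
  obtain ⟨π, h1, h2, h3⟩ := exists_coupling_of_simpleFunc μ.toMeasure ν.toMeasure c
  have hπ : IsProbabilityMeasure π := by
    constructor
    rw [← Set.preimage_univ (f := Prod.fst), ← Measure.map_apply measurable_fst .univ, h1,
      measure_univ]
  have hle : wdist μ ν ≤ (∫⁻ z, ‖z.1 - z.2‖ₑ ^ p ∂π) ^ (1 / p) := iInf₂_le π ⟨h1, h2⟩
  refine (ENNReal.rpow_le_rpow hle hp0.le).trans ?_
  rw [← ENNReal.rpow_mul, one_div_mul_cancel hp0.ne', ENNReal.rpow_one]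
  have hm1 : Measurable fun z : EuclideanSpace ℝ (Fin d) × EuclideanSpace ℝ (Fin d) =>
    tailPow p R z.1 := measurable_tailPow.comp measurable_fst
  have hm2 : Measurable fun z : EuclideanSpace ℝ (Fin d) × EuclideanSpace ℝ (Fin d) =>
    tailPow p R z.2 := measurable_tailPow.comp measurable_snd
  calc ∫⁻ z, ‖z.1 - z.2‖ₑ ^ p ∂π
      ≤ ∫⁻ z, (ε ^ p + 2 ^ p * (tailPow p R z.1 + tailPow p R z.2)
        + {z | c z.1 ≠ c z.2}.indicator (fun _ => (2 * R : ℝ≥0∞) ^ p) z) ∂π :=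
        lintegral_mono fun z => enorm_sub_rpow_le hp0.le hc z.1 z.2
    _ = ε ^ p + 2 ^ p * (∫⁻ y, tailPow p R y ∂μ.toMeasure + ∫⁻ y, tailPow p R y ∂ν.toMeasure)
        + ∫⁻ z, {z | c z.1 ≠ c z.2}.indicator (fun _ => (2 * R : ℝ≥0∞) ^ p) z ∂π := by
        have hm12 : Measurable fun z : EuclideanSpace ℝ (Fin d) × EuclideanSpace ℝ (Fin d) =>
          tailPow p R z.1 + tailPow p R z.2 := hm1.add hm2
        rw [lintegral_add_left ((hm12.const_mul _).const_add _),
          lintegral_add_left measurable_const, lintegral_const_mul _ hm12,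
          lintegral_add_left hm1, lintegral_const, measure_univ, mul_one, ← h1, ← h2,
          lintegral_map measurable_tailPow measurable_fst,
          lintegral_map measurable_tailPow measurable_snd]
    _ ≤ _ := by
        gcongr
        exact (lintegral_indicator_const_le _ _).trans (by gcongr)

end WassersteinSpace

/-- Balls of a finite-dimensional space have finite measurable partitions of arbitrarily small
mesh. -/
theorem exists_simpleFunc_fine_partition {F : Type*} [NormedAddCommGroup F] [ProperSpace F]
    [MeasurableSpace F] [OpensMeasurableSpace F] (R : ℝ≥0) {ε : ℝ≥0∞} (hε : ε ≠ 0) :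
    ∃ c : SimpleFunc F F,
      ∀ y₁ y₂, ‖y₁‖ₑ ≤ R → ‖y₂‖ₑ ≤ R → c y₁ = c y₂ → ‖y₁ - y₂‖ₑ ≤ ε := by
  have hε2 : 0 < ε / 2 := ENNReal.half_pos hε
  set e := TopologicalSpace.denseSeq F
  obtain ⟨t, ht⟩ := (isCompact_closedBall (0 : F) R).elim_finite_subcover
    (fun k => Metric.eball (e k) (ε / 2)) (fun _ => Metric.isOpen_eball) (fun y _ => by
      obtain ⟨k, hk⟩ := (TopologicalSpace.denseRange_denseSeq F).exists_mem_open
        Metric.isOpen_eball ⟨y, Metric.mem_eball_self hε2⟩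
      exact Set.mem_iUnion.2 ⟨k, Metric.mem_eball_comm.1 hk⟩)
  refine ⟨SimpleFunc.nearestPt e (t.sup id), fun y₁ y₂ h1 h2 h => ?_⟩
  have key (y : F) (hy : ‖y‖ₑ ≤ R) : edist (SimpleFunc.nearestPt e (t.sup id) y) y ≤ ε / 2 := by
    have hy' : y ∈ Metric.closedBall (0 : F) R := by
      rw [mem_closedBall_zero_iff]
      rw [enorm_eq_nnnorm] at hy
      exact_mod_cast hy
    obtain ⟨k, hk, hyk⟩ := Set.mem_iUnion₂.1 (ht hy')
    refine (SimpleFunc.edist_nearestPt_le e y (Finset.le_sup (f := id) hk)).trans ?_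
    rw [edist_comm]
    exact (Metric.mem_eball.1 hyk).le
  rw [← edist_eq_enorm_sub, ← ENNReal.add_halves ε]
  refine (edist_triangle_left _ _ _).trans (add_le_add (key _ h1) ?_)
  rw [h]
  exact key _ h2

/-! ### Independence of one observation from the rest -/

section Independence

variable {Ω : Type*} [MeasurableSpace Ω] {P : Measure Ω} [IsProbabilityMeasure P]

theorem IndepFun.prodMk_of_indepFun {α β γ : Type*} [MeasurableSpace α] [MeasurableSpace β]
    [MeasurableSpace γ] {A : Ω → α} {B : Ω → β} {C : Ω → γ} (hA : Measurable A)
    (hB : Measurable B) (hC : Measurable C) (h : IndepFun A (fun ω => (B ω, C ω)) P)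
    (hBC : IndepFun B C P) : IndepFun B (fun ω => (A ω, C ω)) P := by
  have e := (indepFun_iff_map_prod_eq_prod_map_map hA.aemeasurable
    (hB.prodMk hC).aemeasurable).1 h
  have eBC := (indepFun_iff_map_prod_eq_prod_map_map hB.aemeasurable hC.aemeasurable).1 hBC
  have hAC : IndepFun A C P := h.comp measurable_id measurable_snd
  have eAC := (indepFun_iff_map_prod_eq_prod_map_map hA.aemeasurable hC.aemeasurable).1 hAC
  have := Measure.isProbabilityMeasure_map (μ := P) hA.aemeasurable
  have := Measure.isProbabilityMeasure_map (μ := P) hB.aemeasurable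
  have := Measure.isProbabilityMeasure_map (μ := P) hC.aemeasurable
  rw [indepFun_iff_map_prod_eq_prod_map_map hB.aemeasurable (hA.prodMk hC).aemeasurable, eAC]
  rw [eBC] at e
  have hassoc : (P.map A).prod ((P.map B).prod (P.map C))
      = (((P.map A).prod (P.map B)).prod (P.map C)).map MeasurableEquiv.prodAssoc :=
    Measure.prodAssoc_prod.symm
  have hf : Measurable fun z : α × β × γ => (z.2.1, z.1, z.2.2) := by fun_prop
  calc P.map (fun ω => (B ω, A ω, C ω))
      = (P.map (fun ω => (A ω, B ω, C ω))).map (fun z => (z.2.1, z.1, z.2.2)) := by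
        rw [Measure.map_map hf (by fun_prop)]
        rfl
    _ = ((((P.map A).prod (P.map B)).map Prod.swap).prod (P.map C)).map
          MeasurableEquiv.prodAssoc := by
        rw [e, hassoc, Measure.map_map hf MeasurableEquiv.prodAssoc.measurable]
        have : P.map C = (P.map C).map id := Measure.map_id.symm
        conv_rhs => rw [this, Measure.map_prod_map _ _ measurable_swap measurable_id,
          Measure.map_map MeasurableEquiv.prodAssoc.measurable (by fun_prop)]
        rfl
    _ = (P.map B).prod ((P.map A).prod (P.map C)) := by
        rw [Measure.prod_swap, Measure.prodAssoc_prod]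

/-- If `X` is independent of an independent family `Z`, then each `Z i` is independent of the pair
formed by `X` and the rest of the family, encoded as the family with `Z i` overwritten by a
constant. -/
theorem indepFun_prodMk_update {E G ι : Type*} [MeasurableSpace E] [MeasurableSpace G]
    [Fintype ι] [DecidableEq ι] {X : Ω → E} {Z : ι → Ω → G} (hX : Measurable X)
    (hZ : ∀ i, Measurable (Z i)) (h : iIndepFun Z P) (hXZ : IndepFun X (fun ω i => Z i ω) P)
    (i : ι) (z₀ : G) :
    IndepFun (Z i) (fun ω => (X ω, Function.update (fun j => Z j ω) i z₀)) P := by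
  have hC : IndepFun (Z i) (fun ω => Function.update (fun j => Z j ω) i z₀) P := by
    have h1 := h.indepFun_finset {i} (Finset.univ.erase i) (by simp) hZ
    have hm1 : Measurable fun v : ({i} : Finset ι) → G => v ⟨i, Finset.mem_singleton_self i⟩ :=
      measurable_pi_apply _
    have hm2 : Measurable fun (v : ↥(Finset.univ.erase i) → G) (j : ι) =>
        if hj : j = i then z₀ else v ⟨j, Finset.mem_erase.2 ⟨hj, Finset.mem_univ j⟩⟩ := by
      refine measurable_pi_iff.2 fun j => ?_
      by_cases hj : j = i
      · simp only [hj, dite_true]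
        exact measurable_const
      · simp only [hj, dite_false]
        exact measurable_pi_apply _
    have h2 := h1.comp hm1 hm2
    convert h2 using 1
    · rfl
    · funext ω j
      by_cases hj : j = i
      · subst hj; simp
      · simp [hj]
  have hmu : Measurable fun v : ι → G => Function.update v i z₀ := by
    refine measurable_pi_iff.2 fun j => ?_
    by_cases hj : j = i
    · subst hj; simp
    · simpa [hj] using measurable_pi_apply j
  refine IndepFun.prodMk_of_indepFun hX (hZ i) (hmu.comp (measurable_pi_iff.2 hZ)) ?_ hC
  exact hXZ.comp measurable_id ((measurable_pi_apply i).prodMk hmu)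

variable {E F G : Type*} [MeasurableSpace E] [MeasurableSpace F] [MeasurableSpace G]
  {X : Ω → E} {Y : Ω → F} {V : Ω → G} {ν : Measure E} [IsFiniteMeasure ν] {κ : Kernel E F}
  [IsMarkovKernel κ]

/-- If `κ` is the conditional law of `Y` given `X` and `V` is independent of `(X, Y)`, then `κ` is
also the conditional law of `Y` given `(X, V)`. -/
theorem lintegral_mul_comp_eq_lintegral_mul_lintegral_kernel (hX : Measurable X)
    (hY : Measurable Y) (hV : Measurable V) (hlaw : P.map (fun ω => (X ω, Y ω)) = ν ⊗ₘ κ)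
    (hind : IndepFun (fun ω => (X ω, Y ω)) V P) {φ : E × G → ℝ≥0∞} (hφ : Measurable φ)
    {h : F → ℝ≥0∞} (hh : Measurable h) :
    ∫⁻ ω, φ (X ω, V ω) * h (Y ω) ∂P = ∫⁻ ω, φ (X ω, V ω) * ∫⁻ y, h y ∂κ (X ω) ∂P := by
  have e := (indepFun_iff_map_prod_eq_prod_map_map (hX.prodMk hY).aemeasurable
    hV.aemeasurable).1 hind
  have := Measure.isProbabilityMeasure_map (μ := P) hV.aemeasurable
  have hH : Measurable fun x => ∫⁻ y, h y ∂κ x := hh.lintegral_kernel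
  have hT : Measurable fun ω => ((X ω, Y ω), V ω) := (hX.prodMk hY).prodMk hV
  have key (f : (E × F) × G → ℝ≥0∞) (hf : Measurable f) :
      ∫⁻ ω, f ((X ω, Y ω), V ω) ∂P = ∫⁻ v, ∫⁻ x, ∫⁻ y, f ((x, y), v) ∂κ x ∂ν ∂(P.map V) := by
    rw [← lintegral_map hf hT, e, hlaw, lintegral_prod_symm _ hf.aemeasurable]
    exact lintegral_congr fun v =>
      Measure.lintegral_compProd (hf.comp (measurable_id.prodMk measurable_const))
  rw [key (fun z => φ (z.1.1, z.2) * h z.1.2) (by fun_prop),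
    key (fun z => φ (z.1.1, z.2) * ∫⁻ y, h y ∂κ z.1.1)
      ((by fun_prop : Measurable fun z : (E × F) × G => φ (z.1.1, z.2)).mul
        (hH.comp (by fun_prop)))]
  refine lintegral_congr fun v => lintegral_congr fun x => ?_
  simp only
  rw [lintegral_const_mul _ hh, lintegral_const, measure_univ, mul_one]

theorem abs_indicator_sub_measureReal_le_one (μ : Measure F) [IsProbabilityMeasure μ] (A : Set F)
    (y : F) : |A.indicator (fun _ => (1 : ℝ)) y - μ.real A| ≤ 1 := by
  have h0 : 0 ≤ μ.real A := measureReal_nonneg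
  have h1 : μ.real A ≤ 1 := measureReal_le_one
  rw [abs_le]
  by_cases hy : y ∈ A <;> simp only [hy, Set.indicator_of_mem, Set.indicator_of_notMem,
    not_false_eq_true] <;> constructor <;> linarith

/-- The residual of an indicator of `Y` given `X` is orthogonal to bounded functions of `X` and of
variables independent of `(X, Y)`. -/
theorem integral_mul_indicator_sub_kernel_eq_zero (hX : Measurable X)
    (hY : Measurable Y) (hV : Measurable V) (hlaw : P.map (fun ω => (X ω, Y ω)) = ν ⊗ₘ κ)
    (hind : IndepFun (fun ω => (X ω, Y ω)) V P) {φ : E × G → ℝ} (hφ : Measurable φ) {B : ℝ}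
    (hφB : ∀ z, |φ z| ≤ B) {A : Set F} (hA : MeasurableSet A) :
    ∫ ω, φ (X ω, V ω) * (A.indicator (fun _ => (1 : ℝ)) (Y ω) - (κ (X ω)).real A) ∂P = 0 := by
  have e := (indepFun_iff_map_prod_eq_prod_map_map (hX.prodMk hY).aemeasurable
    hV.aemeasurable).1 hind
  have := Measure.isProbabilityMeasure_map (μ := P) hV.aemeasurable
  have hT : Measurable fun ω => ((X ω, Y ω), V ω) := (hX.prodMk hY).prodMk hV
  have hg : Measurable (A.indicator (fun _ => (1 : ℝ))) := measurable_const.indicator hA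
  have hr : Measurable fun x => (κ x).real A := (κ.measurable_coe hA).ennreal_toReal
  set f : (E × F) × G → ℝ := fun z =>
    φ (z.1.1, z.2) * (A.indicator (fun _ => (1 : ℝ)) z.1.2 - (κ z.1.1).real A) with hf_def
  have hf : Measurable f := (hφ.comp (measurable_fst.fst.prodMk measurable_snd)).mul
    ((hg.comp measurable_fst.snd).sub (hr.comp measurable_fst.fst))
  have hfB (z) : ‖f z‖ ≤ B := by
    rw [Real.norm_eq_abs, hf_def, abs_mul]
    calc _ ≤ B * 1 := mul_le_mul (hφB _) (abs_indicator_sub_measureReal_le_one _ A z.1.2)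
          (abs_nonneg _) ((abs_nonneg _).trans (hφB (z.1.1, z.2)))
      _ = B := mul_one B
  calc ∫ ω, f ((X ω, Y ω), V ω) ∂P
      = ∫ z, f z ∂((ν ⊗ₘ κ).prod (P.map V)) := by
        rw [← hlaw, ← e, integral_map hT.aemeasurable hf.aestronglyMeasurable]
    _ = ∫ v, ∫ w, f (w, v) ∂(ν ⊗ₘ κ) ∂(P.map V) :=
        integral_prod_symm _ (Integrable.of_bound hf.aestronglyMeasurable B (.of_forall hfB))
    _ = ∫ _, (0 : ℝ) ∂(P.map V) := by
        refine integral_congr_ae (.of_forall fun v => ?_)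
        have hfv : Measurable fun w => f (w, v) :=
          hf.comp (measurable_id.prodMk measurable_const)
        simp only
        rw [Measure.integral_compProd (Integrable.of_bound hfv.aestronglyMeasurable B
          (.of_forall fun w => hfB _))]
        refine integral_eq_zero_of_ae (.of_forall fun x => ?_)
        simp only [hf_def, Pi.zero_apply]
        rw [integral_const_mul, integral_sub ((integrable_const 1).indicator hA)
          (integrable_const _), integral_indicator_const _ hA]
        simp
    _ = 0 := by simp

end Independence

/-! ### Stone's theorem for indicators and moment bounds -/

/-- Bounded convergence in measure. No measurability is needed because only an upper bound of the
integrals is involved. -/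
theorem tendsto_lintegral_zero_of_bounded {Ω ι : Type*} [MeasurableSpace Ω] {P : Measure Ω}
    [IsProbabilityMeasure P] {l : Filter ι} {f : ι → Ω → ℝ≥0∞} {B : ℝ≥0∞} (hB : B ≠ ∞)
    (hf : ∀ i ω, f i ω ≤ B) (h : ∀ ε, 0 < ε → Tendsto (fun i => P {ω | ε ≤ f i ω}) l (𝓝 0)) :
    Tendsto (fun i => ∫⁻ ω, f i ω ∂P) l (𝓝 0) := by
  refine ENNReal.tendsto_nhds_zero.2 fun ε hε => ?_
  have hε2 : 0 < ε / 2 := ENNReal.half_pos hε.ne'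
  have h1 : Tendsto (fun i => B * P {ω | ε / 2 ≤ f i ω}) l (𝓝 0) := by
    simpa using ENNReal.Tendsto.const_mul (h _ hε2) (Or.inr hB)
  filter_upwards [ENNReal.tendsto_nhds_zero.1 h1 _ hε2] with i hi
  calc ∫⁻ ω, f i ω ∂P
      ≤ ∫⁻ ω, (ε / 2 + {ω | ε / 2 ≤ f i ω}.indicator (fun _ => B) ω) ∂P := by
        refine lintegral_mono fun ω => ?_
        by_cases hω : ε / 2 ≤ f i ω
        · simp only [Set.indicator_of_mem (show ω ∈ {ω | ε / 2 ≤ f i ω} from hω)]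
          exact (hf i ω).trans le_add_self
        · exact (not_le.1 hω).le.trans le_self_add
    _ = ε / 2 + ∫⁻ ω, {ω | ε / 2 ≤ f i ω}.indicator (fun _ => B) ω ∂P := by
        rw [lintegral_add_left measurable_const, lintegral_const, measure_univ, mul_one]
    _ ≤ ε / 2 + ε / 2 := by
        gcongr
        exact (lintegral_indicator_const_le _ _).trans hi
    _ = ε := ENNReal.add_halves ε

/-- A random pair `(X, Y)` together with a sequence of independent copies `(Xs i, Ys i)` that is
independent of it. -/
structure IsSample {E F Ω : Type*} [MeasurableSpace E] [MeasurableSpace F] [MeasurableSpace Ω]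
    (P : Measure Ω) (X : Ω → E) (Y : Ω → F) (Xs : ℕ → Ω → E) (Ys : ℕ → Ω → F) : Prop where
  measurable_fst : Measurable X
  measurable_snd : Measurable Y
  measurable_fst_sample : ∀ i, Measurable (Xs i)
  measurable_snd_sample : ∀ i, Measurable (Ys i)
  identDistrib : ∀ i, IdentDistrib (fun ω => (Xs i ω, Ys i ω)) (fun ω => (X ω, Y ω)) P P
  iIndepFun : iIndepFun (fun i ω => (Xs i ω, Ys i ω)) P
  indepFun : IndepFun (fun ω => (X ω, Y ω)) (fun ω i => (Xs i ω, Ys i ω)) P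

namespace IsSample

variable {E F Ω : Type*} [MeasurableSpace E] [MeasurableSpace F] [MeasurableSpace Ω]
  {P : Measure Ω} {X : Ω → E} {Y : Ω → F} {Xs : ℕ → Ω → E} {Ys : ℕ → Ω → F}

theorem identDistrib_fst (h : IsSample P X Y Xs Ys) (i : ℕ) : IdentDistrib (Xs i) X P P :=
  (h.identDistrib i).comp _root_.measurable_fst

variable [IsProbabilityMeasure P]

theorem map_sample [StandardBorelSpace F] [Nonempty F] (h : IsSample P X Y Xs Ys) (i : ℕ) :
    P.map (fun ω => (Xs i ω, Ys i ω)) = P.map X ⊗ₘ condDistrib Y X P := by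
  rw [(h.identDistrib i).map_eq, compProd_map_condDistrib h.measurable_snd.aemeasurable]

theorem indepFun_update (h : IsSample P X Y Xs Ys) {n : ℕ} (i : Fin n) (z₀ : E × F) :
    IndepFun (fun ω => (Xs i ω, Ys i ω))
      (fun ω => (X ω, Function.update (fun j : Fin n => (Xs j ω, Ys j ω)) i z₀)) P := by
  refine indepFun_prodMk_update (Z := fun (j : Fin n) ω => (Xs j ω, Ys j ω)) h.measurable_fst
    (fun j => (h.measurable_fst_sample j).prodMk (h.measurable_snd_sample j))
    (h.iIndepFun.precomp Fin.val_injective) ?_ i z₀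
  exact h.indepFun.comp (φ := Prod.fst) (ψ := fun z (j : Fin n) => z j) _root_.measurable_fst
    (measurable_pi_iff.2 fun j => measurable_pi_apply _)

theorem lintegral_kernel_comp_fst [StandardBorelSpace F] [Nonempty F]
    (h : IsSample P X Y Xs Ys) {g : F → ℝ≥0∞} (hg : Measurable g) :
    ∫⁻ ω, ∫⁻ y, g y ∂(condDistrib Y X P (X ω)) ∂P = ∫⁻ ω, g (Y ω) ∂P := by
  rw [← lintegral_map (f := fun x => ∫⁻ y, g y ∂condDistrib Y X P x) hg.lintegral_kernel
    h.measurable_fst]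
  have hg2 : Measurable fun z : E × F => g z.2 := hg.comp _root_.measurable_snd
  rw [← Measure.lintegral_compProd hg2,
    compProd_map_condDistrib h.measurable_snd.aemeasurable,
    lintegral_map hg2 (h.measurable_fst.prodMk h.measurable_snd)]

end IsSample

namespace LocalWeights

variable {k d : ℕ} {Ω : Type*}
  {X : Ω → EuclideanSpace ℝ (Fin k)} {Y : Ω → EuclideanSpace ℝ (Fin d)}
  {Xs : ℕ → Ω → EuclideanSpace ℝ (Fin k)} {Ys : ℕ → Ω → EuclideanSpace ℝ (Fin d)}
  {W : LocalWeights k}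

theorem atX_nonneg (n : ℕ+) (i : Fin n) (ω : Ω) : 0 ≤ W.atX X Xs n i ω := W.nonneg _ _ _ _

theorem sum_atX (n : ℕ+) (ω : Ω) : ∑ i, W.atX X Xs n i ω = 1 := W.sum_eq_one _ _ _

theorem atX_le_one (n : ℕ+) (i : Fin n) (ω : Ω) : W.atX X Xs n i ω ≤ 1 :=
  (Finset.single_le_sum (fun j _ => atX_nonneg n j ω) (Finset.mem_univ i)).trans_eq (sum_atX n ω)

theorem sum_ofReal_atX (n : ℕ+) (ω : Ω) : ∑ i, ENNReal.ofReal (W.atX X Xs n i ω) = 1 := by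
  rw [← ENNReal.ofReal_sum_of_nonneg fun i _ => atX_nonneg n i ω, sum_atX, ENNReal.ofReal_one]

/-- The weight `W_{nj}` as a function of the covariate `X_i` and of the remaining data, the pair
formed by `X` and the sample with its `i`-th observation overwritten. -/
def weightSplit (W : LocalWeights k) (d : ℕ) (n : ℕ+) (i j : Fin n)
    (z : EuclideanSpace ℝ (Fin k) × (EuclideanSpace ℝ (Fin k) ×
      (Fin n → EuclideanSpace ℝ (Fin k) × EuclideanSpace ℝ (Fin d)))) : ℝ :=
  W.weight n j z.2.1 fun l => (Function.update z.2.2 i (z.1, 0) l).1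

theorem abs_weightSplit_le_one (n : ℕ+) (i j : Fin n)
    (z : EuclideanSpace ℝ (Fin k) × (EuclideanSpace ℝ (Fin k) ×
      (Fin n → EuclideanSpace ℝ (Fin k) × EuclideanSpace ℝ (Fin d)))) :
    |W.weightSplit d n i j z| ≤ 1 := by
  unfold weightSplit
  rw [abs_of_nonneg (W.nonneg _ _ _ _)]
  exact (Finset.single_le_sum (fun l _ => W.nonneg n l _ _) (Finset.mem_univ j)).trans_eq
    (W.sum_eq_one _ _ _)

theorem measurable_weightSplit (n : ℕ+) (i j : Fin n) : Measurable (W.weightSplit d n i j) := by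
  refine (W.measurable n j).comp (measurable_snd.fst.prodMk (measurable_pi_iff.2 fun l => ?_))
  by_cases hl : l = i
  · subst hl
    simpa using measurable_fst
  · simp only [Function.update_of_ne hl]
    fun_prop

theorem weightSplit_eq_atX (n : ℕ+) (i j : Fin n) (ω : Ω) :
    W.weightSplit d n i j (Xs i ω, (X ω,
      Function.update (fun l : Fin n => (Xs l ω, Ys l ω)) i 0)) = W.atX X Xs n j ω := by
  unfold weightSplit atX
  congr 1
  funext l
  by_cases hl : l = i
  · subst hl; simp
  · simp [hl]

variable [MeasurableSpace Ω] {P : Measure Ω}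

theorem measurable_atX (h : IsSample P X Y Xs Ys) (n : ℕ+) (i : Fin n) :
    Measurable (W.atX X Xs n i) :=
  (W.measurable n i).comp (h.measurable_fst.prodMk
    (measurable_pi_iff.2 fun j : Fin n => h.measurable_fst_sample j))

theorem measurable_update_sample (h : IsSample P X Y Xs Ys) {n : ℕ} (i : Fin n) :
    Measurable fun ω => (X ω, Function.update (fun l : Fin n => (Xs l ω, Ys l ω)) i 0) := by
  refine h.measurable_fst.prodMk (measurable_pi_iff.2 fun l => ?_)
  by_cases hl : l = i
  · subst hl; simp
  · simpa [hl] using (h.measurable_fst_sample l).prodMk (h.measurable_snd_sample l)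

/-- The first of Stone's conditions extends to functions with values in `[0, ∞]`. -/
theorem StoneConditions.exists_bound (hW : W.StoneConditions P X Xs)
    (h : IsSample P X Y Xs Ys) :
    ∃ C : ℝ≥0, ∀ (n : ℕ+) (g : EuclideanSpace ℝ (Fin k) → ℝ≥0∞), Measurable g →
      ∫⁻ ω, ∑ i : Fin n, ENNReal.ofReal (W.atX X Xs n i ω) * g (Xs i ω) ∂P
        ≤ C * ∫⁻ ω, g (X ω) ∂P := by
  obtain ⟨C, hC, hb⟩ := hW.bound
  refine ⟨C, fun n g hg => ?_⟩
  rcases eq_or_ne (∫⁻ ω, g (X ω) ∂P) ∞ with hi | hi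
  · rw [hi, ENNReal.mul_top (by exact_mod_cast hC.ne')]
    exact le_top
  have hX : ∀ᵐ ω ∂P, g (X ω) < ∞ := ae_lt_top (hg.comp h.measurable_fst) hi
  have hXs (i : ℕ) : ∀ᵐ ω ∂P, g (Xs i ω) < ∞ :=
    (h.identDistrib_fst i).symm.ae_snd (p := fun x => g x < ∞) (hg measurableSet_Iio) hX
  have e1 : ∫⁻ ω, ((g (X ω)).toNNReal : ℝ≥0∞) ∂P = ∫⁻ ω, g (X ω) ∂P :=
    lintegral_congr_ae (hX.mono fun ω hω => ENNReal.coe_toNNReal hω.ne)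
  have := hb n (fun x => (g x).toNNReal) hg.ennreal_toNNReal (e1 ▸ hi.lt_top)
  rw [e1] at this
  refine le_of_eq_of_le (lintegral_congr_ae ?_) this
  filter_upwards [ae_all_iff.2 hXs] with ω hω
  exact Finset.sum_congr rfl fun i _ => by rw [ENNReal.coe_toNNReal (hω i).ne]

variable [IsProbabilityMeasure P]

/-- Under the weights, `Y_i` may be replaced by its conditional law given `X_i`. -/
theorem lintegral_atX_mul_snd (h : IsSample P X Y Xs Ys) (n : ℕ+) (i : Fin n)
    {g : EuclideanSpace ℝ (Fin d) → ℝ≥0∞} (hg : Measurable g) :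
    ∫⁻ ω, ENNReal.ofReal (W.atX X Xs n i ω) * g (Ys i ω) ∂P
      = ∫⁻ ω, ENNReal.ofReal (W.atX X Xs n i ω)
        * ∫⁻ y, g y ∂(condDistrib Y X P (Xs i ω)) ∂P := by
  have := lintegral_mul_comp_eq_lintegral_mul_lintegral_kernel (h.measurable_fst_sample i)
    (h.measurable_snd_sample i) (measurable_update_sample h i) (h.map_sample i)
    (h.indepFun_update i 0) (measurable_weightSplit (W := W) n i i).ennreal_ofReal hg
  simpa only [weightSplit_eq_atX] using this

/-- The first of Stone's conditions carries over from the covariates to the responses. -/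
theorem StoneConditions.exists_bound_snd (hW : W.StoneConditions P X Xs)
    (h : IsSample P X Y Xs Ys) :
    ∃ C : ℝ≥0, ∀ (n : ℕ+) (g : EuclideanSpace ℝ (Fin d) → ℝ≥0∞), Measurable g →
      ∫⁻ ω, ∑ i : Fin n, ENNReal.ofReal (W.atX X Xs n i ω) * g (Ys i ω) ∂P
        ≤ C * ∫⁻ ω, g (Y ω) ∂P := by
  obtain ⟨C, hC⟩ := hW.exists_bound h
  refine ⟨C, fun n g hg => ?_⟩
  have hG : Measurable fun x => ∫⁻ y, g y ∂(condDistrib Y X P x) := hg.lintegral_kernel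
  have hw (i : Fin n) : Measurable fun ω => ENNReal.ofReal (W.atX X Xs n i ω) :=
    (measurable_atX h n i).ennreal_ofReal
  rw [← h.lintegral_kernel_comp_fst hg]
  refine le_of_eq_of_le ?_ (hC n _ hG)
  have hwg (i : Fin n) : Measurable fun ω => ENNReal.ofReal (W.atX X Xs n i ω) * g (Ys i ω) :=
    (hw i).mul (hg.comp (h.measurable_snd_sample i))
  have hwG (i : Fin n) : Measurable fun ω => ENNReal.ofReal (W.atX X Xs n i ω)
      * ∫⁻ y, g y ∂(condDistrib Y X P (Xs i ω)) :=
    (hw i).mul (hG.comp (h.measurable_fst_sample i))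
  rw [lintegral_finsetSum _ fun i _ => hwg i, lintegral_finsetSum _ fun i _ => hwG i]
  exact Finset.sum_congr rfl fun i _ => lintegral_atX_mul_snd h n i hg

theorem StoneConditions.tendsto_lintegral_localization (hW : W.StoneConditions P X Xs) {ε : ℝ}
    (hε : 0 < ε) :
    Tendsto (fun n : ℕ+ => ∫⁻ ω, ‖∑ i : Fin n, W.atX X Xs n i ω
      * {x | ε < ‖x - X ω‖}.indicator (fun _ => (1 : ℝ)) (Xs i ω)‖ₑ ∂P) atTop (𝓝 0) := by
  refine tendsto_lintegral_zero_of_bounded ENNReal.one_ne_top (fun n ω => ?_) fun δ hδ => ?_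
  · have h0 (i : Fin n) : 0 ≤ {x | ε < ‖x - X ω‖}.indicator (fun _ => (1 : ℝ)) (Xs i ω) :=
      Set.indicator_nonneg (fun _ _ => zero_le_one) _
    have h1 (i : Fin n) : {x | ε < ‖x - X ω‖}.indicator (fun _ => (1 : ℝ)) (Xs i ω) ≤ 1 :=
      Set.indicator_le_self' (fun _ _ => zero_le_one) _
    rw [Real.enorm_of_nonneg (Finset.sum_nonneg fun i _ => mul_nonneg (atX_nonneg n i ω) (h0 i)),
      ENNReal.ofReal_le_one]
    exact (Finset.sum_le_sum fun i _ => mul_le_of_le_one_right (atX_nonneg n i ω) (h1 i)).trans_eq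
      (sum_atX n ω)
  · simpa only [edist_zero_right] using hW.localization ε hε δ hδ

theorem StoneConditions.tendsto_lintegral_max_weight (hW : W.StoneConditions P X Xs) :
    Tendsto (fun n : ℕ+ => ∫⁻ ω, ‖⨆ i : Fin n, W.atX X Xs n i ω‖ₑ ∂P) atTop (𝓝 0) := by
  refine tendsto_lintegral_zero_of_bounded ENNReal.one_ne_top (fun n ω => ?_) fun δ hδ => ?_
  · rw [Real.enorm_of_nonneg (Real.iSup_nonneg fun i => atX_nonneg n i ω), ENNReal.ofReal_le_one]
    exact Real.iSup_le (fun i => atX_le_one n i ω) zero_le_one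
  · simpa only [edist_zero_right] using hW.max_weight δ hδ

/-- The residual `1_A(y) - F_x(A)` of an observation `(x, y)`, with `F_x` the conditional law of `Y`
given `X = x`. -/
def residual (P : Measure Ω) [IsFiniteMeasure P] (X : Ω → EuclideanSpace ℝ (Fin k))
    (Y : Ω → EuclideanSpace ℝ (Fin d)) (A : Set (EuclideanSpace ℝ (Fin d)))
    (x : EuclideanSpace ℝ (Fin k)) (y : EuclideanSpace ℝ (Fin d)) : ℝ :=
  A.indicator (fun _ => (1 : ℝ)) y - (condDistrib Y X P x).real A

theorem abs_residual_le_one (A : Set (EuclideanSpace ℝ (Fin d))) (x : EuclideanSpace ℝ (Fin k))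
    (y : EuclideanSpace ℝ (Fin d)) : |residual P X Y A x y| ≤ 1 :=
  abs_indicator_sub_measureReal_le_one _ A y

theorem measurable_residual {A : Set (EuclideanSpace ℝ (Fin d))} (hA : MeasurableSet A) :
    Measurable fun z : EuclideanSpace ℝ (Fin k) × EuclideanSpace ℝ (Fin d) =>
      residual P X Y A z.1 z.2 :=
  ((measurable_const.indicator hA).comp measurable_snd).sub
    (((condDistrib Y X P).measurable_coe hA).ennreal_toReal.comp measurable_fst)

/-- Weighted residuals of two different observations are uncorrelated. -/
theorem integral_residual_mul_residual (h : IsSample P X Y Xs Ys) (n : ℕ+) {i j : Fin n}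
    (hij : j ≠ i) {A : Set (EuclideanSpace ℝ (Fin d))} (hA : MeasurableSet A) :
    ∫ ω, (W.atX X Xs n i ω * residual P X Y A (Xs i ω) (Ys i ω))
      * (W.atX X Xs n j ω * residual P X Y A (Xs j ω) (Ys j ω)) ∂P = 0 := by
  have h0 := integral_mul_indicator_sub_kernel_eq_zero (h.measurable_fst_sample i)
    (h.measurable_snd_sample i) (measurable_update_sample h i) (h.map_sample i)
    (h.indepFun_update i 0)
    (φ := fun z => W.weightSplit d n i i z * (W.weightSplit d n i j z
      * residual P X Y A (z.2.2 j).1 (z.2.2 j).2))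
    ((measurable_weightSplit n i i).mul ((measurable_weightSplit n i j).mul
      ((measurable_residual hA).comp ((measurable_pi_apply j).comp measurable_snd.snd))))
    (B := 1) (fun z => ?_) hA
  · simp only [weightSplit_eq_atX, Function.update_of_ne hij] at h0
    rw [← h0]
    refine integral_congr_ae (.of_forall fun ω => ?_)
    simp only [residual]
    ring
  · rw [abs_mul, abs_mul]
    exact mul_le_one₀ (abs_weightSplit_le_one n i i z) (by positivity)
      (mul_le_one₀ (abs_weightSplit_le_one n i j z) (abs_nonneg _) (abs_residual_le_one _ _ _))

/-- The second moment of the weighted sum of residuals is at most the mean of the largest weight. -/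
theorem lintegral_sq_sum_residual_le (h : IsSample P X Y Xs Ys) (n : ℕ+)
    {A : Set (EuclideanSpace ℝ (Fin d))} (hA : MeasurableSet A) :
    ∫⁻ ω, ‖∑ i : Fin n, W.atX X Xs n i ω * residual P X Y A (Xs i ω) (Ys i ω)‖ₑ ^ 2 ∂P
      ≤ ∫⁻ ω, ‖⨆ i : Fin n, W.atX X Xs n i ω‖ₑ ∂P := by
  set f : Fin n → Ω → ℝ := fun i ω => W.atX X Xs n i ω * residual P X Y A (Xs i ω) (Ys i ω)
  have hfm (i) : Measurable (f i) := (measurable_atX h n i).mul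
    ((measurable_residual hA).comp ((h.measurable_fst_sample i).prodMk (h.measurable_snd_sample i)))
  have hfa (i ω) : |f i ω| ≤ W.atX X Xs n i ω := by
    rw [abs_mul, abs_of_nonneg (atX_nonneg n i ω)]
    exact mul_le_of_le_one_right (atX_nonneg n i ω) (abs_residual_le_one _ _ _)
  have hf1 (i ω) : |f i ω| ≤ 1 := (hfa i ω).trans (atX_le_one n i ω)
  have hint (i j) : Integrable (fun ω => f i ω * f j ω) P := by
    refine Integrable.of_bound ((hfm i).mul (hfm j)).aestronglyMeasurable 1 (.of_forall fun ω => ?_)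
    rw [Real.norm_eq_abs, abs_mul]
    exact mul_le_one₀ (hf1 i ω) (abs_nonneg _) (hf1 j ω)
  have hsq (ω) : (∑ i, f i ω) ^ 2 = ∑ i, ∑ j, f i ω * f j ω := by
    rw [sq, Finset.sum_mul_sum]
  have hint2 : Integrable (fun ω => (∑ i, f i ω) ^ 2) P := by
    simp only [hsq]
    exact integrable_finsetSum _ fun i _ => integrable_finsetSum _ fun j _ => hint i j
  have hint3 : Integrable (fun ω => ∑ i, f i ω * f i ω) P :=
    integrable_finsetSum _ fun i _ => hint i i
  have hdiag : ∫ ω, (∑ i, f i ω) ^ 2 ∂P = ∫ ω, ∑ i, f i ω * f i ω ∂P := by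
    simp only [hsq]
    rw [integral_finsetSum _ fun i _ => integrable_finsetSum _ fun j _ => hint i j,
      integral_finsetSum _ fun i _ => hint i i]
    refine Finset.sum_congr rfl fun i _ => ?_
    rw [integral_finsetSum _ fun j _ => hint i j, Finset.sum_eq_single i]
    · exact fun j _ hj => integral_residual_mul_residual h n hj hA
    · simp
  calc ∫⁻ ω, ‖∑ i, f i ω‖ₑ ^ 2 ∂P
      = ∫⁻ ω, ENNReal.ofReal ((∑ i, f i ω) ^ 2) ∂P := by
        refine lintegral_congr fun ω => ?_
        rw [← sq_abs, ENNReal.ofReal_pow (abs_nonneg _), Real.enorm_eq_ofReal_abs]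
    _ = ∫⁻ ω, ENNReal.ofReal (∑ i, f i ω * f i ω) ∂P := by
        rw [← ofReal_integral_eq_lintegral_ofReal hint2 (.of_forall fun ω => sq_nonneg _), hdiag,
          ofReal_integral_eq_lintegral_ofReal hint3
            (.of_forall fun ω => Finset.sum_nonneg fun i _ => mul_self_nonneg _)]
    _ ≤ ∫⁻ ω, ‖⨆ i : Fin n, W.atX X Xs n i ω‖ₑ ∂P := by
        refine lintegral_mono fun ω => ?_
        rw [Real.enorm_of_nonneg (Real.iSup_nonneg fun i => atX_nonneg n i ω)]
        refine ENNReal.ofReal_le_ofReal ?_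
        calc ∑ i, f i ω * f i ω
            ≤ ∑ i, W.atX X Xs n i ω * ⨆ i : Fin n, W.atX X Xs n i ω := by
              refine Finset.sum_le_sum fun i _ => ?_
              rw [← abs_mul_abs_self]
              exact mul_le_mul (hfa i ω) ((hfa i ω).trans
                (le_ciSup (f := fun i : Fin n => W.atX X Xs n i ω) (Set.finite_range _).bddAbove i))
                (abs_nonneg _) (atX_nonneg n i ω)
          _ = ⨆ i : Fin n, W.atX X Xs n i ω := by
              rw [← Finset.sum_mul, sum_atX, one_mul]

theorem StoneConditions.tendsto_lintegral_sum_residual (hW : W.StoneConditions P X Xs)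
    (h : IsSample P X Y Xs Ys) {A : Set (EuclideanSpace ℝ (Fin d))} (hA : MeasurableSet A) :
    Tendsto (fun n : ℕ+ => ∫⁻ ω,
      ‖∑ i : Fin n, W.atX X Xs n i ω * residual P X Y A (Xs i ω) (Ys i ω)‖ₑ ∂P)
      atTop (𝓝 0) := by
  refine tendsto_lintegral_zero_of_bounded ENNReal.one_ne_top (fun n ω => ?_) fun δ hδ => ?_
  · rw [Real.enorm_eq_ofReal_abs, ENNReal.ofReal_le_one,
      ← sum_atX (W := W) (X := X) (Xs := Xs) n ω]
    refine (Finset.abs_sum_le_sum_abs _ _).trans (Finset.sum_le_sum fun i _ => ?_)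
    rw [abs_mul, abs_of_nonneg (atX_nonneg n i ω)]
    exact mul_le_of_le_one_right (atX_nonneg n i ω) (abs_residual_le_one _ _ _)
  · rcases eq_or_ne δ ∞ with rfl | hδt
    · simp
    have hd0 : δ ^ 2 ≠ 0 := pow_ne_zero _ hδ.ne'
    have hdt : δ ^ 2 ≠ ∞ := ENNReal.pow_ne_top hδt
    have hlim : Tendsto (fun n : ℕ+ =>
        (∫⁻ ω, ‖⨆ i : Fin n, W.atX X Xs n i ω‖ₑ ∂P) / δ ^ 2) atTop (𝓝 0) := by
      simpa using ENNReal.Tendsto.div_const hW.tendsto_lintegral_max_weight (Or.inr hd0)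
    refine tendsto_of_tendsto_of_tendsto_of_le_of_le tendsto_const_nhds hlim
      (fun _ => zero_le) fun n => ?_
    rw [ENNReal.le_div_iff_mul_le (Or.inl hd0) (Or.inl hdt), mul_comm]
    refine le_trans ?_ (lintegral_sq_sum_residual_le h n hA)
    refine le_trans ?_ (mul_meas_ge_le_lintegral ?_ (δ ^ 2))
    · exact mul_le_mul_right (measure_mono fun ω hω => ENNReal.pow_le_pow_left hω) _
    · have hm (i : Fin n) : Measurable fun ω =>
          W.atX X Xs n i ω * residual P X Y A (Xs i ω) (Ys i ω) :=
        (measurable_atX h n i).mul ((measurable_residual hA).comp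
          ((h.measurable_fst_sample i).prodMk (h.measurable_snd_sample i)))
      exact (Finset.measurable_fun_sum _ fun i _ => hm i).enorm.pow_const 2

/-- Local averages of an integrable function of the covariate converge in mean: the function is
approximated in mean by a continuous function with compact support, for which localization
suffices. -/
theorem StoneConditions.tendsto_lintegral_sum_fst (hW : W.StoneConditions P X Xs)
    (h : IsSample P X Y Xs Ys) {r : EuclideanSpace ℝ (Fin k) → ℝ} (hr : Measurable r)
    (hri : Integrable r (P.map X)) :
    Tendsto (fun n : ℕ+ => ∫⁻ ω, ‖∑ i : Fin n, W.atX X Xs n i ω * r (Xs i ω) - r (X ω)‖ₑ ∂P)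
      atTop (𝓝 0) := by
  obtain ⟨C, hC⟩ := hW.exists_bound h
  refine ENNReal.tendsto_nhds_zero.2 fun ε hε => ?_
  obtain ⟨η, hη, hηε⟩ : ∃ η : ℝ≥0, 0 < η ∧ (C + 3) * (η : ℝ≥0∞) ≤ ε := by
    rcases eq_or_ne ε ∞ with rfl | hεt
    · exact ⟨1, one_pos, le_top⟩
    lift ε to ℝ≥0 using hεt
    have : 0 < ε := by exact_mod_cast hε
    refine ⟨ε / (C + 3), by positivity, le_of_eq ?_⟩
    norm_cast
    field_simp
  have hη' : (η : ℝ≥0∞) ≠ 0 := by exact_mod_cast hη.ne'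
  have := Measure.isProbabilityMeasure_map (μ := P) h.measurable_fst.aemeasurable
  obtain ⟨s, hsc, hsr, hs, -⟩ := hri.exists_hasCompactSupport_lintegral_sub_le hη'
  have hD : Measurable fun x => ‖r x - s x‖ₑ := (hr.sub hs.measurable).enorm
  rw [lintegral_map hD h.measurable_fst] at hsr
  obtain ⟨M, hM⟩ := hsc.exists_bound_of_continuous hs
  obtain ⟨δ, hδ, hsu⟩ := Metric.uniformContinuous_iff.1
    (hsc.uniformContinuous_of_continuous hs) η (by exact_mod_cast hη)
  have hδ2 : 0 < δ / 2 := half_pos hδ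
  set loc : ℕ+ → Ω → ℝ := fun n ω => ∑ i : Fin n, W.atX X Xs n i ω
      * {x | δ / 2 < ‖x - X ω‖}.indicator (fun _ => (1 : ℝ)) (Xs i ω)
  have hlim : Tendsto (fun n : ℕ+ => ENNReal.ofReal (2 * M) * ∫⁻ ω, ‖loc n ω‖ₑ ∂P)
      atTop (𝓝 0) := by
    have := ENNReal.Tendsto.const_mul (a := ENNReal.ofReal (2 * M))
      (hW.tendsto_lintegral_localization hδ2) (Or.inr ENNReal.ofReal_ne_top)
    rwa [mul_zero] at this
  filter_upwards [ENNReal.tendsto_nhds_zero.1 hlim η (pos_iff_ne_zero.2 hη')] with n hn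
  have hcont (x x' : EuclideanSpace ℝ (Fin k)) : ‖s x' - s x‖ₑ ≤ η + ENNReal.ofReal (2 * M)
      * ENNReal.ofReal ({x' | δ / 2 < ‖x' - x‖}.indicator (fun _ => (1 : ℝ)) x') := by
    by_cases hx : δ / 2 < ‖x' - x‖
    · refine le_trans ?_ le_add_self
      rw [Set.indicator_of_mem (by exact hx), ENNReal.ofReal_one, mul_one, Real.enorm_eq_ofReal_abs]
      refine ENNReal.ofReal_le_ofReal ?_
      have h1 := hM x
      have h2 := hM x'
      rw [Real.norm_eq_abs] at h1 h2
      linarith [abs_sub (s x') (s x)]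
    · refine le_trans ?_ le_self_add
      have h1 : dist (s x') (s x) < η := hsu (by rw [dist_eq_norm]; linarith)
      rw [Real.dist_eq] at h1
      rw [Real.enorm_eq_ofReal_abs]
      exact (ENNReal.ofReal_le_ofReal h1.le).trans_eq (ENNReal.ofReal_coe_nnreal)
  have hpt (ω : Ω) : ‖∑ i : Fin n, W.atX X Xs n i ω * r (Xs i ω) - r (X ω)‖ₑ
      ≤ ∑ i : Fin n, ENNReal.ofReal (W.atX X Xs n i ω) * ‖r (Xs i ω) - s (Xs i ω)‖ₑ
        + (‖r (X ω) - s (X ω)‖ₑ + (η + ENNReal.ofReal (2 * M) * ‖loc n ω‖ₑ)) := by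
    have e1 : ∑ i : Fin n, W.atX X Xs n i ω * r (Xs i ω) - r (X ω)
        = ∑ i : Fin n, W.atX X Xs n i ω * (r (Xs i ω) - r (X ω)) := by
      simp only [mul_sub, Finset.sum_sub_distrib, ← Finset.sum_mul, sum_atX, one_mul]
    have e2 : ‖loc n ω‖ₑ = ∑ i : Fin n, ENNReal.ofReal (W.atX X Xs n i ω) * ENNReal.ofReal
        ({x | δ / 2 < ‖x - X ω‖}.indicator (fun _ => (1 : ℝ)) (Xs i ω)) := by
      have h0 (i : Fin n) : 0 ≤ {x | δ / 2 < ‖x - X ω‖}.indicator (fun _ => (1 : ℝ)) (Xs i ω) :=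
        Set.indicator_nonneg (fun _ _ => zero_le_one) _
      have h1 (i : Fin n) := mul_nonneg (atX_nonneg (W := W) (X := X) (Xs := Xs) n i ω) (h0 i)
      rw [Real.enorm_of_nonneg (Finset.sum_nonneg fun i _ => h1 i),
        ENNReal.ofReal_sum_of_nonneg fun i _ => h1 i]
      exact Finset.sum_congr rfl fun i _ => ENNReal.ofReal_mul (atX_nonneg n i ω)
    have e3 : ‖r (X ω) - s (X ω)‖ₑ + (η + ENNReal.ofReal (2 * M) * ‖loc n ω‖ₑ)
        = ∑ i : Fin n, ENNReal.ofReal (W.atX X Xs n i ω) * (‖r (X ω) - s (X ω)‖ₑ + (η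
          + ENNReal.ofReal (2 * M) * ENNReal.ofReal
            ({x | δ / 2 < ‖x - X ω‖}.indicator (fun _ => (1 : ℝ)) (Xs i ω)))) := by
      simp only [mul_add, Finset.sum_add_distrib, ← Finset.sum_mul, sum_ofReal_atX, one_mul, e2,
        Finset.mul_sum, mul_left_comm (ENNReal.ofReal (2 * M))]
    rw [e1, e3, ← Finset.sum_add_distrib]
    refine (enorm_sum_le _ _).trans (Finset.sum_le_sum fun i _ => ?_)
    rw [enorm_mul, Real.enorm_of_nonneg (atX_nonneg n i ω), ← mul_add]
    gcongr
    have e4 : r (Xs i ω) - r (X ω) = (r (Xs i ω) - s (Xs i ω)) + (-(r (X ω) - s (X ω))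
      + (s (Xs i ω) - s (X ω))) := by ring
    rw [e4]
    refine (enorm_add_le _ _).trans (add_le_add le_rfl ((enorm_add_le _ _).trans ?_))
    rw [enorm_neg]
    exact add_le_add le_rfl (hcont _ _)
  have hDX : Measurable fun ω => ‖r (X ω) - s (X ω)‖ₑ := hD.comp h.measurable_fst
  have hsm : Measurable fun ω => ∑ i : Fin n,
      ENNReal.ofReal (W.atX X Xs n i ω) * ‖r (Xs i ω) - s (Xs i ω)‖ₑ :=
    Finset.measurable_fun_sum _ fun i _ =>
      (measurable_atX h n i).ennreal_ofReal.mul (hD.comp (h.measurable_fst_sample i))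
  calc _ ≤ ∫⁻ ω, (∑ i : Fin n, ENNReal.ofReal (W.atX X Xs n i ω) * ‖r (Xs i ω) - s (Xs i ω)‖ₑ
        + (‖r (X ω) - s (X ω)‖ₑ + (η + ENNReal.ofReal (2 * M) * ‖loc n ω‖ₑ))) ∂P :=
        lintegral_mono hpt
    _ = ∫⁻ ω, ∑ i : Fin n, ENNReal.ofReal (W.atX X Xs n i ω) * ‖r (Xs i ω) - s (Xs i ω)‖ₑ ∂P
        + (∫⁻ ω, ‖r (X ω) - s (X ω)‖ₑ ∂P
        + (η + ENNReal.ofReal (2 * M) * ∫⁻ ω, ‖loc n ω‖ₑ ∂P)) := by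
        rw [lintegral_add_left hsm, lintegral_add_left hDX, lintegral_add_left measurable_const,
          lintegral_const, measure_univ, mul_one, lintegral_const_mul' _ _ ENNReal.ofReal_ne_top]
    _ ≤ C * η + (η + (η + η)) := by
        gcongr
        exact (hC n _ hD).trans (by gcongr)
    _ = (C + 3) * η := by ring
    _ ≤ ε := hηε

/-- Stone's theorem for an indicator: the weighted empirical frequency of `A` converges in mean to
the conditional probability of `A`. -/
theorem StoneConditions.tendsto_lintegral_sum_indicator (hW : W.StoneConditions P X Xs)
    (h : IsSample P X Y Xs Ys) {A : Set (EuclideanSpace ℝ (Fin d))} (hA : MeasurableSet A) :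
    Tendsto (fun n : ℕ+ => ∫⁻ ω, ‖∑ i : Fin n, W.atX X Xs n i ω
      * A.indicator (fun _ => (1 : ℝ)) (Ys i ω) - (condDistrib Y X P (X ω)).real A‖ₑ ∂P)
      atTop (𝓝 0) := by
  have hr : Measurable fun x => (condDistrib Y X P x).real A :=
    ((condDistrib Y X P).measurable_coe hA).ennreal_toReal
  have := Measure.isProbabilityMeasure_map (μ := P) h.measurable_fst.aemeasurable
  have hri : Integrable (fun x => (condDistrib Y X P x).real A) (P.map X) :=
    Integrable.of_bound hr.aestronglyMeasurable 1 (.of_forall fun x => by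
      rw [Real.norm_of_nonneg measureReal_nonneg]
      exact measureReal_le_one)
  have hlim := (hW.tendsto_lintegral_sum_residual h hA).add (hW.tendsto_lintegral_sum_fst h hr hri)
  rw [add_zero] at hlim
  refine tendsto_of_tendsto_of_tendsto_of_le_of_le tendsto_const_nhds hlim (fun _ => zero_le)
    fun n => ?_
  have hm : Measurable fun ω => ∑ i : Fin n,
      W.atX X Xs n i ω * residual P X Y A (Xs i ω) (Ys i ω) :=
    Finset.measurable_fun_sum _ fun i _ =>
      (measurable_atX h n i).mul ((measurable_residual hA).comp
        ((h.measurable_fst_sample i).prodMk (h.measurable_snd_sample i)))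
  simp only
  rw [← lintegral_add_left hm.enorm]
  refine lintegral_mono fun ω => le_trans (le_of_eq ?_) (enorm_add_le _ _)
  congr 1
  simp only [residual, mul_sub, Finset.sum_sub_distrib]
  ring

end LocalWeights

/-! ### Convergence of the weighted empirical distribution in Wasserstein distance -/

namespace LocalWeights

section Empirical

variable {k d : ℕ} {Ω : Type*} {X : Ω → EuclideanSpace ℝ (Fin k)}
  {Xs : ℕ → Ω → EuclideanSpace ℝ (Fin k)} {Ys : ℕ → Ω → EuclideanSpace ℝ (Fin d)}
  {W : LocalWeights k} {p : ℝ}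

theorem lintegral_empirical (hp : 1 ≤ p) (n : ℕ+) (ω : Ω)
    (g : EuclideanSpace ℝ (Fin d) → ℝ≥0∞) :
    ∫⁻ y, g y ∂(W.empirical hp n (X ω) (fun i : Fin n => Xs i ω)
      (fun i : Fin n => Ys i ω)).toMeasure
      = ∑ i : Fin n, ENNReal.ofReal (W.atX X Xs n i ω) * g (Ys i ω) := by
  simp only [empirical, lintegral_finsetSum_measure, lintegral_smul_measure, lintegral_dirac,
    smul_eq_mul, atX]

theorem empirical_apply (hp : 1 ≤ p) (n : ℕ+) (ω : Ω) {A : Set (EuclideanSpace ℝ (Fin d))}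
    (hA : MeasurableSet A) :
    (W.empirical hp n (X ω) (fun i : Fin n => Xs i ω) (fun i : Fin n => Ys i ω)).toMeasure A
      = ENNReal.ofReal (∑ i : Fin n, W.atX X Xs n i ω
        * A.indicator (fun _ => (1 : ℝ)) (Ys i ω)) := by
  rw [← lintegral_indicator_one hA, lintegral_empirical, ENNReal.ofReal_sum_of_nonneg fun i _ =>
    mul_nonneg (atX_nonneg n i ω) (Set.indicator_nonneg (fun _ _ => zero_le_one) _)]
  refine Finset.sum_congr rfl fun i _ => ?_
  rw [ENNReal.ofReal_mul (atX_nonneg n i ω)]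
  by_cases hy : Ys i ω ∈ A <;> simp [hy]

end Empirical

variable {k d : ℕ} {Ω : Type*} [MeasurableSpace Ω] {P : Measure Ω}
  {X : Ω → EuclideanSpace ℝ (Fin k)} {Y : Ω → EuclideanSpace ℝ (Fin d)}
  {Xs : ℕ → Ω → EuclideanSpace ℝ (Fin k)} {Ys : ℕ → Ω → EuclideanSpace ℝ (Fin d)}
  {W : LocalWeights k}

theorem measurable_sum_atX_mul (h : IsSample P X Y Xs Ys) (n : ℕ+)
    {g : EuclideanSpace ℝ (Fin d) → ℝ≥0∞} (hg : Measurable g) :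
    Measurable fun ω => ∑ i : Fin n, ENNReal.ofReal (W.atX X Xs n i ω) * g (Ys i ω) :=
  Finset.measurable_fun_sum _ fun i _ =>
    (measurable_atX h n i).ennreal_ofReal.mul (hg.comp (h.measurable_snd_sample i))

theorem tendsto_lintegral_tailPow_comp {p : ℝ} (hY : Measurable Y)
    (hYp : ∫⁻ ω, ‖Y ω‖ₑ ^ p ∂P ≠ ∞) :
    Tendsto (fun N : ℕ => ∫⁻ ω, tailPow p N (Y ω) ∂P) atTop (𝓝 0) := by
  rw [← lintegral_map (f := fun y => ‖y‖ₑ ^ p) (measurable_enorm.pow_const p) hY] at hYp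
  simpa only [lintegral_map measurable_tailPow hY] using tendsto_lintegral_tailPow hYp

variable [IsProbabilityMeasure P]

theorem measurable_lintegral_condDistrib (h : IsSample P X Y Xs Ys)
    {g : EuclideanSpace ℝ (Fin d) → ℝ≥0∞} (hg : Measurable g) :
    Measurable fun ω => ∫⁻ y, g y ∂(condDistrib Y X P (X ω)) :=
  (hg.lintegral_kernel (κ := condDistrib Y X P)).comp h.measurable_fst

/-- Integrals of `g` for the conditional law and for the weighted empirical law are, in mean,
controlled by `E[g(Y)]` uniformly in the sample size. -/
theorem StoneConditions.exists_bound_condDistrib_add (hW : W.StoneConditions P X Xs)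
    (h : IsSample P X Y Xs Ys) :
    ∃ C : ℝ≥0, ∀ (n : ℕ+) (g : EuclideanSpace ℝ (Fin d) → ℝ≥0∞), Measurable g →
      ∫⁻ ω, (∫⁻ y, g y ∂(condDistrib Y X P (X ω))
        + ∑ i : Fin n, ENNReal.ofReal (W.atX X Xs n i ω) * g (Ys i ω)) ∂P
        ≤ C * ∫⁻ ω, g (Y ω) ∂P := by
  obtain ⟨C, hC⟩ := hW.exists_bound_snd h
  refine ⟨1 + C, fun n g hg => ?_⟩
  rw [lintegral_add_left (measurable_lintegral_condDistrib h hg), h.lintegral_kernel_comp_fst hg,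
    ENNReal.coe_add, ENNReal.coe_one, add_mul, one_mul]
  exact add_le_add le_rfl (hC n g hg)

/-- The `p`-th power of the Wasserstein distance between the conditional law and the weighted
empirical law is, for large samples, dominated by a random variable of arbitrarily small mean. The
measurable bound makes up for the distance not being known to be measurable. -/
theorem StoneConditions.eventually_exists_wdist_bound {p : ℝ} (hp : 1 ≤ p)
    (hW : W.StoneConditions P X Xs) (h : IsSample P X Y Xs Ys)
    (hYp : ∫⁻ ω, ‖Y ω‖ₑ ^ p ∂P ≠ ∞) {η : ℝ≥0∞} (hη : η ≠ 0) :
    ∀ᶠ n : ℕ+ in atTop, ∃ U : Ω → ℝ≥0∞, Measurable U ∧ ∫⁻ ω, U ω ∂P ≤ η ∧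
      ∀ ω (hω : HasFiniteMoment p (condDistrib Y X P (X ω))),
        WassersteinSpace.wdist ⟨condDistrib Y X P (X ω), hω⟩
          (W.empirical hp n (X ω) (fun i : Fin n => Xs i ω) (fun i : Fin n => Ys i ω)) ^ p
          ≤ U ω := by
  have hp0 : 0 < p := by linarith
  obtain ⟨C, hC⟩ := hW.exists_bound_condDistrib_add h
  have hη3 : 0 < η / 3 := ENNReal.div_pos hη (by norm_num)
  have h2p : (2 : ℝ≥0∞) ^ p ≠ ∞ := ENNReal.rpow_ne_top_of_nonneg hp0.le (by norm_num)
  have htail : Tendsto (fun N : ℕ => 2 ^ p * (C * ∫⁻ ω, tailPow p N (Y ω) ∂P)) atTop (𝓝 0) := by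
    have := ENNReal.Tendsto.const_mul (a := (2 : ℝ≥0∞) ^ p) (ENNReal.Tendsto.const_mul
      (tendsto_lintegral_tailPow_comp h.measurable_snd hYp)
      (Or.inr (ENNReal.coe_ne_top (r := C)))) (Or.inr h2p)
    simpa using this
  obtain ⟨N, hN⟩ := (ENNReal.tendsto_nhds_zero.1 htail _ hη3).exists
  set R : ℝ≥0 := (N : ℝ≥0)
  set ε : ℝ≥0∞ := (η / 3) ^ (1 / p)
  have hε : ε ≠ 0 := (ENNReal.rpow_pos_of_nonneg hη3 (by positivity)).ne'
  have hεp : ε ^ p = η / 3 := by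
    rw [← ENNReal.rpow_mul, one_div_mul_cancel hp0.ne', ENNReal.rpow_one]
  obtain ⟨c, hc⟩ := exists_simpleFunc_fine_partition (F := EuclideanSpace ℝ (Fin d)) R hε
  set Δ : ℕ+ → EuclideanSpace ℝ (Fin d) → Ω → ℝ≥0∞ := fun n j ω => ‖∑ i : Fin n, W.atX X Xs n i ω
      * (c ⁻¹' {j}).indicator (fun _ => (1 : ℝ)) (Ys i ω)
      - (condDistrib Y X P (X ω)).real (c ⁻¹' {j})‖ₑ with hΔ
  have hΔm (n j) : Measurable (Δ n j) := by
    have h1 : Measurable fun ω => ∑ i : Fin n, W.atX X Xs n i ω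
        * (c ⁻¹' {j}).indicator (fun _ => (1 : ℝ)) (Ys i ω) :=
      Finset.measurable_fun_sum _ fun i _ => (measurable_atX h n i).mul
        ((measurable_const.indicator (c.measurableSet_fiber j)).comp (h.measurable_snd_sample i))
    exact (h1.sub (((condDistrib Y X P).measurable_coe
      (c.measurableSet_fiber j)).ennreal_toReal.comp h.measurable_fst)).enorm
  have hRp : (2 * R : ℝ≥0∞) ^ p ≠ ∞ := ENNReal.rpow_ne_top_of_nonneg hp0.le
    (ENNReal.mul_ne_top (by norm_num) ENNReal.coe_ne_top)
  have hlim : Tendsto (fun n : ℕ+ => (2 * R : ℝ≥0∞) ^ p * ∑ j ∈ c.range, ∫⁻ ω, Δ n j ω ∂P)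
      atTop (𝓝 0) := by
    have := ENNReal.Tendsto.const_mul (a := (2 * R : ℝ≥0∞) ^ p)
      (tendsto_finsetSum c.range fun j _ =>
        hW.tendsto_lintegral_sum_indicator h (c.measurableSet_fiber j)) (Or.inr hRp)
    simpa using this
  filter_upwards [ENNReal.tendsto_nhds_zero.1 hlim _ hη3] with n hn
  set T : Ω → ℝ≥0∞ := fun ω => ∫⁻ y, tailPow p R y ∂(condDistrib Y X P (X ω))
        + ∑ i : Fin n, ENNReal.ofReal (W.atX X Xs n i ω) * tailPow p R (Ys i ω)
  have hTm : Measurable T := (measurable_lintegral_condDistrib h measurable_tailPow).add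
    (measurable_sum_atX_mul h n measurable_tailPow)
  have hSm : Measurable fun ω => ∑ j ∈ c.range, Δ n j ω :=
    Finset.measurable_fun_sum _ fun j _ => hΔm n j
  refine ⟨fun ω => ε ^ p + 2 ^ p * T ω + (2 * R : ℝ≥0∞) ^ p * ∑ j ∈ c.range, Δ n j ω,
    ((hTm.const_mul _).const_add _).add (hSm.const_mul _), ?_, fun ω hω => ?_⟩
  · rw [lintegral_add_left ((hTm.const_mul _).const_add _), lintegral_add_left measurable_const,
      lintegral_const, measure_univ, mul_one, lintegral_const_mul _ hTm, lintegral_const_mul _ hSm,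
      lintegral_finsetSum _ fun j _ => hΔm n j, hεp]
    refine (add_le_add (add_le_add le_rfl (le_trans ?_ hN)) hn).trans_eq (ENNReal.add_thirds η)
    gcongr
    exact hC n _ measurable_tailPow
  · refine (WassersteinSpace.wdist_rpow_le hp _ _ c hc).trans ?_
    rw [lintegral_empirical]
    refine add_le_add le_rfl (mul_le_mul_right (Finset.sum_le_sum fun j _ => ?_) _)
    rw [empirical_apply hp n ω (c.measurableSet_fiber j), hΔ]
    simp only
    rw [Real.enorm_eq_ofReal_abs, ← ofReal_measureReal (μ := condDistrib Y X P (X ω)),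
      ← ENNReal.ofReal_sub _
      (Finset.sum_nonneg fun i _ => mul_nonneg (atX_nonneg n i ω)
        (Set.indicator_nonneg (fun _ _ => zero_le_one) _)), abs_sub_comm]
    exact ENNReal.ofReal_le_ofReal (le_abs_self _)

/-- Convergence in probability of the plug-in estimator. Any subsequence has a further one along
which the Wasserstein distance to the conditional law vanishes almost surely. -/
theorem StoneConditions.tendstoInMeasure_plugIn {p : ℝ} (hp : 1 ≤ p)
    (hW : W.StoneConditions P X Xs) (h : IsSample P X Y Xs Ys)
    (hYp : ∫⁻ ω, ‖Y ω‖ₑ ^ p ∂P ≠ ∞) {S : WassersteinSpace p d → ℝ}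
    (hS : ∀ n, AEMeasurable (W.plugIn hp S X Xs Ys n) P)
    (hC : ∀ᵐ ω ∂P, ∃ h : HasFiniteMoment p (condDistrib Y X P (X ω)),
      (⟨condDistrib Y X P (X ω), h⟩ : WassersteinSpace p d) ∈
        WassersteinSpace.continuitySet S) :
    TendstoInMeasure P (W.plugIn hp S X Xs Ys) atTop (condStatistic P S X Y) := by
  have hp0 : 0 < p := by linarith
  intro ε hε
  refine tendsto_of_subseq_tendsto fun ns hns => ?_
  -- summable means, so that the dominating variables tend to zero almost surely
  have hex (m : ℕ) := (hns.eventually (hW.eventually_exists_wdist_bound hp h hYp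
    (η := 2⁻¹ ^ m) (pow_ne_zero _ (by norm_num)))).exists
  choose ms U hUm hU hUd using hex
  refine ⟨ms, tendstoInMeasure_of_tendsto_ae (f := fun m => W.plugIn hp S X Xs Ys (ns (ms m)))
    (g := condStatistic P S X Y) (fun m => (hS _).aestronglyMeasurable) ?_ ε hε⟩
  have hsum : ∫⁻ ω, ∑' m, U m ω ∂P ≠ ∞ := by
    rw [lintegral_tsum fun m => (hUm m).aemeasurable]
    refine ne_top_of_le_ne_top ?_ (ENNReal.tsum_le_tsum hU)
    rw [ENNReal.tsum_geometric]
    simp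
  filter_upwards [hC, ae_lt_top (Measurable.tsum hUm) hsum] with ω ⟨hω, hcont⟩ hlt
  have hU0 := ENNReal.tendsto_atTop_zero_of_tsum_ne_top hlt.ne
  rw [condStatistic, dif_pos hω, Metric.tendsto_nhds]
  intro e he
  obtain ⟨δ, hδ, hSδ⟩ := hcont e he
  filter_upwards [hU0.eventually_lt_const (ENNReal.rpow_pos_of_nonneg hδ hp0.le)] with m hm
  rw [Real.dist_eq]
  exact hSδ _ ((ENNReal.rpow_lt_rpow_iff hp0).1 ((hUd m ω hω).trans_lt hm))

end LocalWeights

/-! ### Convergence of moments -/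

theorem WassersteinSpace.ofReal_moment_rpow {p : ℝ} (hp : 0 < p) {d : ℕ}
    (μ : WassersteinSpace p d) :
    ENNReal.ofReal (μ.moment ^ p) = ∫⁻ y, ‖y‖ₑ ^ p ∂μ.toMeasure := by
  have h0 : 0 ≤ ∫ y, ‖y‖ ^ p ∂μ.toMeasure :=
    integral_nonneg fun y => Real.rpow_nonneg (norm_nonneg y) p
  have he (y : EuclideanSpace ℝ (Fin d)) : ENNReal.ofReal (‖y‖ ^ p) = ‖y‖ₑ ^ p := by
    rw [← ENNReal.ofReal_rpow_of_nonneg (norm_nonneg y) hp.le, ofReal_norm]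
  have hm : Measurable fun y : EuclideanSpace ℝ (Fin d) => ‖y‖ ^ p := measurable_norm.pow_const p
  have hmp : μ.moment ^ p = ∫ y, ‖y‖ ^ p ∂μ.toMeasure := by
    rw [moment, ← Real.rpow_mul h0, one_div_mul_cancel hp.ne', Real.rpow_one]
  have hfin := μ.hasFiniteMoment.2
  simp only [← he] at hfin ⊢
  rw [hmp, integral_eq_lintegral_of_nonneg_ae
    (.of_forall fun y => Real.rpow_nonneg (norm_nonneg y) p) hm.aestronglyMeasurable]
  exact ENNReal.ofReal_toReal hfin.ne

theorem rpow_le_add_add_of_le_add_add {x u v w s : ℝ} (hx : 0 ≤ x) (hu : 0 ≤ u) (hv : 0 ≤ v)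
    (hw : 0 ≤ w) (hs : 0 ≤ s) (h : x ≤ u + v + w) :
    x ^ s ≤ (3 * u) ^ s + (3 * v) ^ s + (3 * w) ^ s := by
  have h1 : 0 ≤ (3 * u) ^ s := by positivity
  have h2 : 0 ≤ (3 * v) ^ s := by positivity
  have h3 : 0 ≤ (3 * w) ^ s := by positivity
  by_cases c1 : x ≤ 3 * u
  · linarith [Real.rpow_le_rpow hx c1 hs]
  by_cases c2 : x ≤ 3 * v
  · linarith [Real.rpow_le_rpow hx c2 hs]
  have c3 : x ≤ 3 * w := by linarith
  linarith [Real.rpow_le_rpow hx c3 hs]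

/-- A statistic with growth of order `q` has increments whose power `p / q` grows like the moments
of order `p`. -/
theorem WassersteinSpace.ofReal_abs_sub_rpow_le {p : ℝ} (hp : 0 < p) {d : ℕ}
    {S : WassersteinSpace p d → ℝ} {a b q : ℝ} (ha : 0 ≤ a) (hb : 0 ≤ b) (hq : 0 < q)
    (hS : ∀ μ : WassersteinSpace p d, |S μ| ≤ a * μ.moment ^ q + b)
    (μ ν : WassersteinSpace p d) :
    ENNReal.ofReal (|S μ - S ν| ^ (p / q))
      ≤ ENNReal.ofReal ((3 * a) ^ (p / q))
          * (∫⁻ y, ‖y‖ₑ ^ p ∂μ.toMeasure + ∫⁻ y, ‖y‖ₑ ^ p ∂ν.toMeasure)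
        + ENNReal.ofReal ((3 * (2 * b)) ^ (p / q)) := by
  have hs : 0 ≤ p / q := by positivity
  have hm (ξ : WassersteinSpace p d) : 0 ≤ ξ.moment :=
    Real.rpow_nonneg (integral_nonneg fun y => Real.rpow_nonneg (norm_nonneg y) p) _
  have hpow (ξ : WassersteinSpace p d) :
      (3 * (a * ξ.moment ^ q)) ^ (p / q) = (3 * a) ^ (p / q) * ξ.moment ^ p := by
    rw [← mul_assoc, Real.mul_rpow (by positivity) (Real.rpow_nonneg (hm ξ) q),
      ← Real.rpow_mul (hm ξ), mul_div_cancel₀ p hq.ne']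
  have hle : |S μ - S ν| ≤ a * μ.moment ^ q + a * ν.moment ^ q + 2 * b := by
    linarith [abs_sub (S μ) (S ν), hS μ, hS ν]
  have h0 (ξ : WassersteinSpace p d) : 0 ≤ a * ξ.moment ^ q :=
    mul_nonneg ha (Real.rpow_nonneg (hm ξ) q)
  have hc : 0 ≤ (3 * a) ^ (p / q) := by positivity
  refine (ENNReal.ofReal_le_ofReal (rpow_le_add_add_of_le_add_add (abs_nonneg _) (h0 μ) (h0 ν)
    (by positivity) hs hle)).trans ?_
  rw [hpow, hpow, ← mul_add, ENNReal.ofReal_add (mul_nonneg hc (add_nonneg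
    (Real.rpow_nonneg (hm μ) p) (Real.rpow_nonneg (hm ν) p))) (by positivity),
    ENNReal.ofReal_mul hc, ENNReal.ofReal_add (Real.rpow_nonneg (hm μ) p)
    (Real.rpow_nonneg (hm ν) p), ofReal_moment_rpow hp, ofReal_moment_rpow hp]

namespace LocalWeights

variable {k d : ℕ} {Ω : Type*} [MeasurableSpace Ω] {P : Measure Ω} [IsProbabilityMeasure P]
  {X : Ω → EuclideanSpace ℝ (Fin k)} {Y : Ω → EuclideanSpace ℝ (Fin d)}
  {Xs : ℕ → Ω → EuclideanSpace ℝ (Fin k)} {Ys : ℕ → Ω → EuclideanSpace ℝ (Fin d)}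
  {W : LocalWeights k}

/-- Convergence in probability of the plug-in estimator improves to convergence of moments: up to
tails of small mean, the power of the error is bounded, so that it may be truncated. -/
theorem StoneConditions.tendsto_lintegral_plugIn {p : ℝ} (hp : 1 ≤ p)
    (hW : W.StoneConditions P X Xs) (h : IsSample P X Y Xs Ys)
    (hYp : ∫⁻ ω, ‖Y ω‖ₑ ^ p ∂P ≠ ∞) {S : WassersteinSpace p d → ℝ}
    (hF : ∀ᵐ ω ∂P, HasFiniteMoment p (condDistrib Y X P (X ω)))
    (hlim : TendstoInMeasure P (W.plugIn hp S X Xs Ys) atTop (condStatistic P S X Y))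
    {a b q : ℝ} (ha : 0 ≤ a) (hb : 0 ≤ b) (hq : 0 < q)
    (hS : ∀ μ : WassersteinSpace p d, |S μ| ≤ a * μ.moment ^ q + b) :
    Tendsto (fun n : ℕ+ => ∫⁻ ω, ENNReal.ofReal
      (|W.plugIn hp S X Xs Ys n ω - condStatistic P S X Y ω| ^ (p / q)) ∂P) atTop (𝓝 0) := by
  have hp0 : 0 < p := by linarith
  have hs : 0 < p / q := by positivity
  obtain ⟨C, hC⟩ := hW.exists_bound_condDistrib_add h
  set D : ℕ+ → Ω → ℝ≥0∞ := fun n ω => ENNReal.ofReal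
      (|W.plugIn hp S X Xs Ys n ω - condStatistic P S X Y ω| ^ (p / q)) with hD
  set c : ℝ≥0∞ := ENNReal.ofReal ((3 * a) ^ (p / q))
  have hc : c ≠ ∞ := ENNReal.ofReal_ne_top
  refine ENNReal.tendsto_nhds_zero.2 fun η hη => ?_
  have hη2 : 0 < η / 2 := ENNReal.half_pos hη.ne'
  have htail : Tendsto (fun N : ℕ => c * (C * ∫⁻ ω, tailPow p N (Y ω) ∂P)) atTop (𝓝 0) := by
    have := ENNReal.Tendsto.const_mul (a := c) (ENNReal.Tendsto.const_mul
      (tendsto_lintegral_tailPow_comp h.measurable_snd hYp)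
      (Or.inr (ENNReal.coe_ne_top (r := C)))) (Or.inr hc)
    simpa using this
  obtain ⟨N, hN⟩ := (ENNReal.tendsto_nhds_zero.1 htail _ hη2).exists
  set R : ℝ≥0 := (N : ℝ≥0)
  set B : ℝ≥0∞ := c * (R ^ p + R ^ p) + ENNReal.ofReal ((3 * (2 * b)) ^ (p / q)) with hB
  have hRp : (R : ℝ≥0∞) ^ p ≠ ∞ := ENNReal.rpow_ne_top_of_nonneg hp0.le ENNReal.coe_ne_top
  have hBt : B ≠ ∞ := ENNReal.add_ne_top.2
    ⟨ENNReal.mul_ne_top hc (ENNReal.add_ne_top.2 ⟨hRp, hRp⟩), ENNReal.ofReal_ne_top⟩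
  set T : ℕ+ → Ω → ℝ≥0∞ := fun n ω => ∫⁻ y, tailPow p R y ∂(condDistrib Y X P (X ω))
        + ∑ i : Fin n, ENNReal.ofReal (W.atX X Xs n i ω) * tailPow p R (Ys i ω)
  have hTm (n) : Measurable (T n) := (measurable_lintegral_condDistrib h measurable_tailPow).add
    (measurable_sum_atX_mul h n measurable_tailPow)
  have hmom (μ : WassersteinSpace p d) : ∫⁻ y, ‖y‖ₑ ^ p ∂μ.toMeasure
      ≤ R ^ p + ∫⁻ y, tailPow p R y ∂μ.toMeasure := by
    have := μ.hasFiniteMoment.1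
    refine (lintegral_mono fun y => enorm_rpow_le_add_tailPow (R := R) hp0.le y).trans_eq ?_
    rw [lintegral_add_left measurable_const, lintegral_const, measure_univ, mul_one]
  have hDle (n : ℕ+) : ∀ᵐ ω ∂P, D n ω ≤ min (D n ω) B + c * T n ω := by
    filter_upwards [hF] with ω hω
    have h1 : D n ω ≤ B + c * T n ω := by
      simp only [hD, condStatistic, dif_pos hω]
      rw [abs_sub_comm]
      refine (WassersteinSpace.ofReal_abs_sub_rpow_le hp0 ha hb hq hS _ _).trans ?_
      refine (add_le_add (mul_le_mul_right (add_le_add (hmom _) (hmom _)) c) le_rfl).trans_eq ?_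
      rw [lintegral_empirical, hB]
      ring
    rcases le_total (D n ω) B with h2 | h2
    · rw [min_eq_left h2]
      exact le_self_add
    · rwa [min_eq_right h2]
  have hmin : Tendsto (fun n : ℕ+ => ∫⁻ ω, min (D n ω) B ∂P) atTop (𝓝 0) := by
    refine tendsto_lintegral_zero_of_bounded hBt (fun _ _ => min_le_right _ _) fun ε hε => ?_
    refine tendsto_of_tendsto_of_tendsto_of_le_of_le tendsto_const_nhds
      (hlim (ε ^ (p / q)⁻¹) (ENNReal.rpow_pos_of_nonneg hε (by positivity))) (fun _ => zero_le)
      fun n => measure_mono fun ω hω => ?_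
    have h1 : ε ≤ D n ω := le_trans hω (min_le_left _ _)
    simp only [hD] at h1
    rw [← ENNReal.ofReal_rpow_of_nonneg (abs_nonneg _) hs.le, ← Real.enorm_eq_ofReal_abs,
      ← edist_eq_enorm_sub] at h1
    exact (ENNReal.rpow_inv_le_iff hs).2 h1
  filter_upwards [ENNReal.tendsto_nhds_zero.1 hmin _ hη2] with n hn
  calc ∫⁻ ω, D n ω ∂P ≤ ∫⁻ ω, (min (D n ω) B + c * T n ω) ∂P := lintegral_mono_ae (hDle n)
    _ = ∫⁻ ω, min (D n ω) B ∂P + c * ∫⁻ ω, T n ω ∂P := by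
        rw [lintegral_add_right _ ((hTm n).const_mul c), lintegral_const_mul _ (hTm n)]
    _ ≤ η / 2 + η / 2 := by
        refine add_le_add hn (le_trans ?_ hN)
        gcongr
        exact hC n _ measurable_tailPow
    _ = η := ENNReal.add_halves η

end LocalWeights

end

theorem proposition2 {k d : ℕ} {p : ℝ} (hp : 1 ≤ p)
    {Ω : Type*} [MeasurableSpace Ω] (P : Measure Ω) [IsProbabilityMeasure P]
    (X : Ω → EuclideanSpace ℝ (Fin k)) (Y : Ω → EuclideanSpace ℝ (Fin d))
    (Xs : ℕ → Ω → EuclideanSpace ℝ (Fin k)) (Ys : ℕ → Ω → EuclideanSpace ℝ (Fin d))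
    (hX : Measurable X) (hY : Measurable Y)
    (hXs : ∀ i, Measurable (Xs i)) (hYs : ∀ i, Measurable (Ys i))
    -- the sample consists of independent copies of `(X, Y)`
    (h_ident : ∀ i, IdentDistrib (fun ω => (Xs i ω, Ys i ω)) (fun ω => (X ω, Y ω)) P P)
    (h_indep : iIndepFun (fun i ω => (Xs i ω, Ys i ω)) P)
    (h_indep_new : IndepFun (fun ω => (X ω, Y ω)) (fun ω i => (Xs i ω, Ys i ω)) P)
    -- local probability weights satisfying the conditions of Stone's theorem
    (W : LocalWeights k) (hW : W.StoneConditions P X Xs)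
    -- the statistic `S`, and the plug-in estimators are random variables
    (S : WassersteinSpace p d → ℝ)
    (hS : ∀ n, AEMeasurable (W.plugIn hp S X Xs Ys n) P)
    (hYp : Integrable (fun ω => ‖Y ω‖ ^ p) P)
    (hC : ∀ᵐ ω ∂P, ∃ h : HasFiniteMoment p (condDistrib Y X P (X ω)),
      (⟨condDistrib Y X P (X ω), h⟩ : WassersteinSpace p d) ∈ WassersteinSpace.continuitySet S) :
    TendstoInMeasure P (W.plugIn hp S X Xs Ys) atTop (condStatistic P S X Y) ∧
    ∀ a b q : ℝ, 0 ≤ a → 0 ≤ b → 0 < q → q ≤ p →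
      (∀ μ : WassersteinSpace p d, |S μ| ≤ a * μ.moment ^ q + b) →
      Tendsto (fun n : ℕ+ =>
          ∫⁻ ω, ENNReal.ofReal (|W.plugIn hp S X Xs Ys n ω - condStatistic P S X Y ω| ^ (p / q)) ∂P)
        atTop (𝓝 0) := by
  have h : IsSample P X Y Xs Ys := ⟨hX, hY, hXs, hYs, h_ident, h_indep, h_indep_new⟩
  have hp0 : 0 ≤ p := by linarith
  have hYp' : ∫⁻ ω, ‖Y ω‖ₑ ^ p ∂P ≠ ∞ := by
    refine ne_of_eq_of_ne (lintegral_congr fun ω => ?_) hYp.lintegral_lt_top.ne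
    rw [← ENNReal.ofReal_rpow_of_nonneg (norm_nonneg _) hp0, ofReal_norm]
  have hlim := hW.tendstoInMeasure_plugIn hp h hYp' hS hC
  exact ⟨hlim, fun a b q ha hb hq _ hSq =>
    hW.tendsto_lintegral_plugIn hp h hYp' (hC.mono fun ω hω => hω.1) hlim ha hb hq hSq⟩
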